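/- An encryption scheme on a $D$-dimensional quantum system is given by finitely many unitaries $U_k$ and probabilities $w_k$; it acts by $\mathcal E(\rho)=\sum_k w_kU_k\rho U_k^\dagger$, and its entropy is $-\sum_k w_k\log_2 w_k$. It has error at most $\varepsilon$ in the $2$-norm if $\|\mathcal E(\rho)-\mathbb I/D\|_2\le\varepsilon/\sqrt D$ for all states $\rho$, and in the $\infty$-norm if $\|\mathcal E(\rho)-\mathbb I/D\|_\infty\le\varepsilon/D$ for all states $\rho$, where $\|\cdot\|_2$ is the Frobenius norm and $\|\cdot\|_\infty$ the operator norm. A single-qubit Pauli scheme is $\rho\mapsto w\rho+xX\rho X+yY\rho Y+zZ\rho Z$, with key probabilities $(w,x,y,z)$. An independent $n$-qubit scheme is $R=R_1\otimes\cdots\otimes R_n$ with single-qubit schemes $R_i$ whose keys are drawn independently. Theorem 2. For every $H\in[0,2]$ and either of the two norms there is a Pauli scheme $P$ of entropy $H$ with the smallest error $\varepsilon$ among the single-qubit Pauli schemes of entropy $H$. For any such $P$ (optimal in either of the two norms, with error $\varepsilon$), and all $n$: 1. In both norms $P^{\otimes n}$ is optimal among the independent $n$-qubit schemes whose factors have entropy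 $H$ each, and even among those whose factors have entropy at most $H$ each: whenever such a scheme has error at most $\delta$, so does $P^{\otimes n}$. 2. $\|P^{\otimes n}(\rho)-\mathbb I/2^n\|_2\le\sqrt n\,\frac{\varepsilon}{2^{n/2}}+\frac{g_2(n,\varepsilon)}{2^{n/2}}$ for all states $\rho$, with a universal function $g_2(n,\varepsilon)=o(\varepsilon\sqrt n)$ as $\varepsilon\sqrt n\to0$, and equality holds for some product state. 3. $\|P^{\otimes n}(\rho)-\mathbb I/2^n\|_\infty\le n\,\frac{\varepsilon}{2^n}+\frac{g_\infty(n,\varepsilon)}{2^n}$ for all states $\rho$, with a universal function $g_\infty(n,\varepsilon)=o(n\varepsilon)$ as $n\varepsilon\to0$, and equality holds for some product state. Consequently, for either norm and every fixed $\delta$ there is a function $f(n)=o(n)$ such that every independent $n$-qubit scheme (whose factors may have different entropies) with error at most $\delta$ has entropy at least $2n-f(n)$. -/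

import Mathlib

open Filter Topology Asymptotics
open scoped ComplexOrder

noncomputable section

/-- A quantum encryption scheme on the system with basis `d`: with probability `weight k` the
unitary `unitary k` is applied. The finite set of keys is arbitrary. -/
structure EncryptionScheme (d : Type) [Fintype d] [DecidableEq d] where
  key : Type
  fintypeKey : Fintype key
  weight : key → ℝ
  weight_nonneg : ∀ k, 0 ≤ weight k
  weight_sum : ∑ k, weight k = 1
  unitary : key → Matrix.unitaryGroup d ℂ

attribute [instance] EncryptionScheme.fintypeKey

/-- Density matrices: positive semidefinite with unit trace. -/
def IsState {d : Type} [Fintype d] (ρ : Matrix d d ℂ) : Prop :=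
  ρ.PosSemidef ∧ ρ.trace = 1

/-- The two norms in which the quality of an encryption is measured. -/
inductive NormIndex where
  | two
  | infty

/-- The 2-norm (square root of the sum of the squared singular values, which is the Frobenius
norm) and the operator norm. -/
def schattenNorm {d : Type} [Fintype d] [DecidableEq d] (ν : NormIndex) (A : Matrix d d ℂ) : ℝ :=
  match ν with
  | .two => @norm _ (Matrix.frobeniusNormedAddCommGroup (m := d) (n := d) (α := ℂ)).toNorm A
  | .infty => @norm _ (Matrix.instL2OpNormedAddCommGroup (m := d) (n := d) (𝕜 := ℂ)).toNorm A

/-- The normalization of the error in dimension `D`: `√D` for the 2-norm, `D` for the operator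
norm. -/
def NormIndex.scale (ν : NormIndex) (D : ℕ) : ℝ :=
  match ν with
  | .two => √(D : ℝ)
  | .infty => (D : ℝ)

namespace EncryptionScheme

variable {d : Type} [Fintype d] [DecidableEq d]

/-- Shannon entropy, in bits, of the key distribution. -/
def entropy (S : EncryptionScheme d) : ℝ :=
  -∑ k, S.weight k * Real.logb 2 (S.weight k)

/-- The ciphertext `∑ w_k U_k ρ U_k†`. -/
def encrypt (S : EncryptionScheme d) (ρ : Matrix d d ℂ) : Matrix d d ℂ :=
  ∑ k, (S.weight k : ℂ) •
    ((S.unitary k : Matrix d d ℂ) * ρ * (S.unitary k : Matrix d d ℂ).conjTranspose)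

/-- The distance of the encryption of `ρ` from the completely mixed state `I / D`, where `D` is
the dimension. -/
def distMixed (S : EncryptionScheme d) (ν : NormIndex) (ρ : Matrix d d ℂ) : ℝ :=
  schattenNorm ν (S.encrypt ρ - ((Fintype.card d : ℂ)⁻¹) • (1 : Matrix d d ℂ))

/-- All states are encrypted up to `ε / √D` in the 2-norm, up to `ε / D` in the operator norm. -/
def ErrorLe (S : EncryptionScheme d) (ν : NormIndex) (ε : ℝ) : Prop :=
  ∀ ρ : Matrix d d ℂ, IsState ρ → S.distMixed ν ρ ≤ ε / ν.scale (Fintype.card d)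

/-- `S` is an `(ε, H)`-approximate encryption scheme for the norm `ν`. -/
def IsApproximate (S : EncryptionScheme d) (ν : NormIndex) (ε H : ℝ) : Prop :=
  S.entropy = H ∧ S.ErrorLe ν ε

end EncryptionScheme

/-- The tensor product of `n` single-qubit matrices, in the computational basis `{0,1}^n`. -/
def tensorMatrix {n : ℕ} (A : Fin n → Matrix (Fin 2) (Fin 2) ℂ) :
    Matrix (Fin n → Fin 2) (Fin n → Fin 2) ℂ :=
  Matrix.of fun x y => ∏ i, A i (x i) (y i)

theorem tensorMatrix_mul {n : ℕ} (A B : Fin n → Matrix (Fin 2) (Fin 2) ℂ) :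
    tensorMatrix A * tensorMatrix B = tensorMatrix fun i => A i * B i := by
  ext x y
  simp only [tensorMatrix, Matrix.mul_apply, Matrix.of_apply, ← Finset.prod_mul_distrib]
  rw [Finset.prod_univ_sum, Fintype.piFinset_univ]

theorem tensorMatrix_star {n : ℕ} (A : Fin n → Matrix (Fin 2) (Fin 2) ℂ) :
    star (tensorMatrix A) = tensorMatrix fun i => star (A i) := by
  ext x y
  simp [tensorMatrix, Matrix.star_apply]

theorem tensorMatrix_one {n : ℕ} :
    (tensorMatrix fun _ : Fin n => (1 : Matrix (Fin 2) (Fin 2) ℂ)) = 1 := by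
  ext x y
  by_cases h : x = y
  · subst h
    simp [tensorMatrix]
  · obtain ⟨i, hi⟩ := Function.ne_iff.mp h
    simp only [tensorMatrix, Matrix.of_apply, Matrix.one_apply_ne h]
    exact Finset.prod_eq_zero (Finset.mem_univ i) (Matrix.one_apply_ne hi)

/-- The independent scheme `S_1 ⊗ ⋯ ⊗ S_n`: the keys are drawn independently and each unitary acts
on its own qubit. -/
def tensorScheme {n : ℕ} (S : Fin n → EncryptionScheme (Fin 2)) :
    EncryptionScheme (Fin n → Fin 2) where
  key := ∀ i, (S i).key
  fintypeKey := inferInstance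
  weight k := ∏ i, (S i).weight (k i)
  weight_nonneg k := Finset.prod_nonneg fun i _ => (S i).weight_nonneg (k i)
  weight_sum := by
    classical
    rw [← Fintype.prod_sum]
    simp [EncryptionScheme.weight_sum]
  unitary k :=
    ⟨tensorMatrix fun i => ((S i).unitary (k i) : Matrix (Fin 2) (Fin 2) ℂ), by
      rw [Matrix.mem_unitaryGroup_iff, tensorMatrix_star, tensorMatrix_mul]
      simp_rw [fun i => Matrix.mem_unitaryGroup_iff.mp ((S i).unitary (k i)).2]
      exact tensorMatrix_one⟩

/-- The Pauli matrices `I, X, Y, Z`. -/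
def pauli : Fin 4 → Matrix (Fin 2) (Fin 2) ℂ :=
  ![!![1, 0; 0, 1], !![0, 1; 1, 0], !![0, -Complex.I; Complex.I, 0], !![1, 0; 0, -1]]

theorem pauli_mem_unitaryGroup (k : Fin 4) : pauli k ∈ Matrix.unitaryGroup (Fin 2) ℂ := by
  rw [Matrix.mem_unitaryGroup_iff]
  ext i j
  fin_cases k <;> fin_cases i <;> fin_cases j <;>
    simp [pauli, Matrix.mul_apply, Fin.sum_univ_two, Matrix.star_apply]

/-- The Pauli scheme `ρ ↦ w ρ + x X ρ X + y Y ρ Y + z Z ρ Z` of a probability vector. -/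
def pauliScheme (p : stdSimplex ℝ (Fin 4)) : EncryptionScheme (Fin 2) where
  key := Fin 4
  fintypeKey := inferInstance
  weight := p.1
  weight_nonneg := p.2.1
  weight_sum := p.2.2
  unitary k := ⟨pauli k, pauli_mem_unitaryGroup k⟩

/-- Among the single-qubit Pauli schemes of entropy `H`, the one with weights `p` achieves the
optimal approximation parameter, `ε`, in the norm `ν`. -/
def IsOptimalPauli (ν : NormIndex) (p : stdSimplex ℝ (Fin 4)) (ε H : ℝ) : Prop :=
  (pauliScheme p).IsApproximate ν ε H ∧
    ∀ (q : stdSimplex ℝ (Fin 4)) (ε' : ℝ), (pauliScheme q).IsApproximate ν ε' H → ε ≤ ε'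

/-- The scheme `P^{⊗n}` for the Pauli scheme `P` with weights `p`. -/
def pauliPower (p : stdSimplex ℝ (Fin 4)) (n : ℕ) : EncryptionScheme (Fin n → Fin 2) :=
  tensorScheme fun _ => pauliScheme p

end

/-! Up to a phase, a single-qubit unitary is a unit quaternion `v` in `ℝ⁴`, and conjugation by it is
quadratic in `v`. A single-qubit scheme thus acts only through the matrix `∑ w_k v_k v_kᵀ`. An
orthonormal eigenframe of this matrix behaves like `I, X, Y, Z` between two choices of basis, so the
scheme is a Pauli scheme in disguise, with the eigenvalues as weights; the spectrum has at most the
entropy of the mixture (`EncryptionScheme.exists_pauli`). Mixing in the uniform key raises the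
entropy to exactly `H` without increasing the error, so no scheme of entropy at most `H` beats the
optimal Pauli scheme.

A Pauli scheme multiplies the three Bloch coordinates by real factors. Their largest modulus,
`pauliNorm`, is its error `ε` in both norms, which is why the norm in which `P` is optimal does not
matter. `P^{⊗n}` multiplies the Pauli string `σ_s` by at most `ε^|s|` in modulus. The central
estimate, `IsState.sum_pauliWeight_le`, is `∑ η^|s| |tr(σ_s ρ)|² ≤ (1+η)^n` for every state,
entangled or not. Taking `η = ε²` bounds the 2-norm distance; taking `η = ε`, after testing against
a pure state, bounds the operator norm.

Conversely, a product of bad single-qubit inputs, with output Bloch lengths `m_i`, has squared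
2-norm distance `(∏(1+m_i²)-1)/2^n` and operator distance at least `(∏(1+m_i)-1)/2^n`
(`exists_product_state`). The two sides together give optimality and the exact worst cases
`√((1+ε²)^n-1)/2^{n/2}` and `((1+ε)^n-1)/2^n`, with leading terms `√n ε` and `n ε`.

Finally, the entropy deficit of a Pauli scheme is at most quadratic in its factor, and an error `δ`
bounds `∑ m_i²` independently of `n`; the total deficit is even bounded. -/

/-! ### Frobenius and operator norms -/

theorem schattenNorm_nonneg {d : Type} [Fintype d] [DecidableEq d] (ν : NormIndex)
    (A : Matrix d d ℂ) : 0 ≤ schattenNorm ν A := by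
  cases ν
  · let _ := Matrix.frobeniusNormedAddCommGroup (m := d) (n := d) (α := ℂ)
    exact norm_nonneg A
  · let _ := Matrix.instL2OpNormedAddCommGroup (m := d) (n := d) (𝕜 := ℂ)
    exact norm_nonneg A

theorem schattenNorm_two_sq {d : Type} [Fintype d] [DecidableEq d] (A : Matrix d d ℂ) :
    schattenNorm .two A ^ 2 = ∑ x, ∑ y, ‖A x y‖ ^ 2 := by
  have h : schattenNorm .two A = (∑ i, ∑ j, ‖A i j‖ ^ (2 : ℝ)) ^ (1 / 2 : ℝ) :=
    Matrix.frobenius_norm_def A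
  rw [h, ← Real.sqrt_eq_rpow, Real.sq_sqrt (by positivity)]
  simp

theorem sum_norm_sq_eq_trace {d : Type} [Fintype d] (A : Matrix d d ℂ) :
    ((∑ x, ∑ y, ‖A x y‖ ^ 2 : ℝ) : ℂ) = (A * A.conjTranspose).trace := by
  simp [Matrix.trace, Matrix.mul_apply, Complex.mul_conj, Complex.normSq_eq_norm_sq]

theorem card_ne_zero_of_trace_eq_one {d : Type} [Fintype d] {A : Matrix d d ℂ}
    (h : A.trace = 1) : Fintype.card d ≠ 0 := by
  intro h0
  have := Fintype.card_eq_zero_iff.mp h0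
  simp [Matrix.trace] at h

/-- For unit trace the squared 2-norm distance is the purity minus `1/D`, and purity is
multiplicative over tensor factors. -/
theorem schattenNorm_two_sub_sq {d : Type} [Fintype d] [DecidableEq d] {A : Matrix d d ℂ}
    (h : A.trace = 1) :
    schattenNorm .two (A - ((Fintype.card d : ℂ)⁻¹) • (1 : Matrix d d ℂ)) ^ 2 =
      ∑ x, ∑ y, ‖A x y‖ ^ 2 - (Fintype.card d : ℝ)⁻¹ := by
  have hc : (Fintype.card d : ℝ) ≠ 0 := by exact_mod_cast card_ne_zero_of_trace_eq_one h
  rw [schattenNorm_two_sq]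
  set c : ℝ := (Fintype.card d : ℝ)⁻¹ with hcdef
  have hcc : ((Fintype.card d : ℂ)⁻¹) = (c : ℂ) := by simp [hcdef]
  rw [hcc]
  have key : ∀ x y, ‖(A - (c : ℂ) • (1 : Matrix d d ℂ)) x y‖ ^ 2 =
      ‖A x y‖ ^ 2 + (if x = y then c ^ 2 - 2 * c * (A x x).re else 0) := by
    intro x y
    by_cases hxy : x = y
    · subst hxy
      simp only [Matrix.sub_apply, Matrix.smul_apply, Matrix.one_apply_eq, smul_eq_mul, mul_one,
        if_true, ← Complex.normSq_eq_norm_sq, Complex.normSq_apply, Complex.sub_re,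
        Complex.sub_im, Complex.ofReal_re, Complex.ofReal_im]
      ring
    · simp [Matrix.one_apply_ne hxy, hxy]
  have htr : ∑ x, (A x x).re = 1 := by
    have := congrArg Complex.re h
    simpa [Matrix.trace] using this
  simp_rw [key, Finset.sum_add_distrib]
  simp only [Finset.sum_ite_eq, Finset.mem_univ, if_true, Finset.sum_sub_distrib,
    Finset.sum_const, ← Finset.mul_sum, htr, nsmul_eq_mul, Finset.card_univ]
  have : (Fintype.card d : ℝ) * c = 1 := mul_inv_cancel₀ hc
  linear_combination c * this

theorem le_schattenNorm_infty {d : Type} [Fintype d] [DecidableEq d] {A : Matrix d d ℂ}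
    {v : d → ℂ} (hv : v ≠ 0) {μ : ℝ} (h : A.mulVec v = (μ : ℂ) • v) :
    |μ| ≤ schattenNorm .infty A := by
  have h1 := Matrix.l2_opNorm_mulVec A (WithLp.toLp 2 v)
  have h2 : ‖WithLp.toLp 2 (A.mulVec v)‖ = |μ| * ‖WithLp.toLp 2 v‖ := by
    rw [h, WithLp.toLp_smul, norm_smul]
    simp
  have h3 : 0 < ‖WithLp.toLp 2 v‖ := by
    rw [norm_pos_iff]
    simpa using hv
  refine le_of_mul_le_mul_right ?_ h3
  rw [← h2]
  exact h1

/-- By the spectral theorem the norm is the largest modulus of an eigenvalue, and each eigenvalue is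
the quadratic form at a unit eigenvector. -/
theorem schattenNorm_infty_le {d : Type} [Fintype d] [DecidableEq d] {A : Matrix d d ℂ}
    (hA : A.IsHermitian) {c : ℝ} (hc : 0 ≤ c)
    (h : ∀ v : d → ℂ, star v ⬝ᵥ v = 1 → ‖star v ⬝ᵥ A.mulVec v‖ ≤ c) :
    schattenNorm .infty A ≤ c := by
  have hev : ∀ i, |hA.eigenvalues i| ≤ c := by
    intro i
    have hn : star (hA.eigenvectorBasis i : d → ℂ) ⬝ᵥ (hA.eigenvectorBasis i : d → ℂ) = 1 := by
      have := hA.eigenvectorBasis.orthonormal.1 i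
      have h2 := inner_self_eq_norm_sq_to_K (𝕜 := ℂ) (hA.eigenvectorBasis i)
      rw [this] at h2
      rw [EuclideanSpace.inner_eq_star_dotProduct, dotProduct_comm] at h2
      simpa using h2
    have := h _ hn
    rw [hA.mulVec_eigenvectorBasis, dotProduct_smul, hn] at this
    simpa using this
  have hs := hA.spectral_theorem
  change @norm _ (Matrix.instL2OpNormedAddCommGroup (m := d) (n := d) (𝕜 := ℂ)).toNorm A ≤ c
  rw [hs, Unitary.conjStarAlgAut_apply]
  open scoped Matrix.Norms.L2Operator in
  rw [← Unitary.coe_star, CStarRing.norm_mul_coe_unitary, CStarRing.norm_coe_unitary_mul]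
  open scoped Matrix.Norms.L2Operator in
  rw [Matrix.l2_opNorm_diagonal, pi_norm_le_iff_of_nonneg hc]
  intro i
  simpa using hev i

/-! ### Tensor products of schemes and states -/

theorem tensorScheme_encrypt {n : ℕ} (S : Fin n → EncryptionScheme (Fin 2))
    (ξ : Fin n → Matrix (Fin 2) (Fin 2) ℂ) :
    (tensorScheme S).encrypt (tensorMatrix ξ) = tensorMatrix fun i => (S i).encrypt (ξ i) := by
  have h : ∀ k : (∀ i, (S i).key),
      (((tensorScheme S).unitary k : Matrix _ _ ℂ) * tensorMatrix ξ *
        ((tensorScheme S).unitary k : Matrix _ _ ℂ).conjTranspose) =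
      tensorMatrix fun i => ((S i).unitary (k i) : Matrix (Fin 2) (Fin 2) ℂ) * ξ i *
        ((S i).unitary (k i) : Matrix (Fin 2) (Fin 2) ℂ).conjTranspose := by
    intro k
    change tensorMatrix _ * tensorMatrix ξ * star (tensorMatrix _) = _
    rw [tensorMatrix_star, tensorMatrix_mul, tensorMatrix_mul]
    rfl
  ext x y
  have e : (tensorScheme S).encrypt (tensorMatrix ξ) = ∑ k : (∀ i, (S i).key),
      ((∏ i, (S i).weight (k i) : ℝ) : ℂ) • (tensorMatrix fun i =>
        ((S i).unitary (k i) : Matrix (Fin 2) (Fin 2) ℂ) * ξ i *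
        ((S i).unitary (k i) : Matrix (Fin 2) (Fin 2) ℂ).conjTranspose) := by
    simp_rw [← h]
    rfl
  rw [e]
  simp only [Matrix.sum_apply, Matrix.smul_apply, tensorMatrix, Matrix.of_apply,
    EncryptionScheme.encrypt, smul_eq_mul]
  push_cast
  simp_rw [← Finset.prod_mul_distrib]
  classical
  rw [Finset.prod_univ_sum, Fintype.piFinset_univ]

theorem tensorMatrix_trace {n : ℕ} (A : Fin n → Matrix (Fin 2) (Fin 2) ℂ) :
    (tensorMatrix A).trace = ∏ i, (A i).trace := by
  simp only [Matrix.trace, tensorMatrix, Matrix.diag_apply, Matrix.of_apply]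
  rw [Finset.prod_univ_sum, Fintype.piFinset_univ]

theorem IsState.tensorMatrix {n : ℕ} {ξ : Fin n → Matrix (Fin 2) (Fin 2) ℂ}
    (h : ∀ i, IsState (ξ i)) : IsState (tensorMatrix ξ) := by
  constructor
  · have : ∀ i, ∃ B : Matrix (Fin 2) (Fin 2) ℂ, ξ i = star B * B := by
      intro i
      open scoped MatrixOrder in
      exact CStarAlgebra.nonneg_iff_eq_star_mul_self.mp (h i).1.nonneg
    choose B hB using this
    rw [funext hB, ← tensorMatrix_mul, ← tensorMatrix_star]
    exact Matrix.posSemidef_conjTranspose_mul_self _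
  · rw [tensorMatrix_trace]
    exact Finset.prod_eq_one fun i _ => (h i).2

theorem sum_norm_sq_tensorMatrix {n : ℕ} (A : Fin n → Matrix (Fin 2) (Fin 2) ℂ) :
    ∑ x, ∑ y, ‖tensorMatrix A x y‖ ^ 2 = ∏ i, ∑ x, ∑ y, ‖A i x y‖ ^ 2 := by
  rw [Finset.prod_univ_sum, Fintype.piFinset_univ]
  refine Finset.sum_congr rfl fun x _ => ?_
  rw [Finset.prod_univ_sum, Fintype.piFinset_univ]
  refine Finset.sum_congr rfl fun y _ => ?_
  simp only [tensorMatrix, Matrix.of_apply, norm_prod, Finset.prod_pow]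

theorem tensorMatrix_mulVec {n : ℕ} (A : Fin n → Matrix (Fin 2) (Fin 2) ℂ)
    (v : Fin n → Fin 2 → ℂ) :
    (tensorMatrix A).mulVec (fun x => ∏ i, v i (x i)) =
      fun x => ∏ i, (A i).mulVec (v i) (x i) := by
  ext x
  simp only [Matrix.mulVec, dotProduct, tensorMatrix, Matrix.of_apply, ← Finset.prod_mul_distrib]
  rw [Finset.prod_univ_sum, Fintype.piFinset_univ]

/-! ### Bloch form of qubit operators and bad product inputs -/

/-- The matrix `(1 + t N) / 2`: a qubit operator with Bloch vector of length `|t|` if `N` is a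
traceless Hermitian involution. -/
noncomputable def blochMatrix (t : ℝ) (N : Matrix (Fin 2) (Fin 2) ℂ) : Matrix (Fin 2) (Fin 2) ℂ :=
  (2⁻¹ : ℂ) • (1 + (t : ℂ) • N)

/-- Traceless Hermitian involutions: the observables `n · σ` of unit vectors `n`. -/
structure IsSpin (N : Matrix (Fin 2) (Fin 2) ℂ) : Prop where
  isHermitian : N.IsHermitian
  mul_self : N * N = 1
  trace_eq_zero : N.trace = 0

namespace IsSpin

variable {N : Matrix (Fin 2) (Fin 2) ℂ}

theorem trace_blochMatrix (hN : IsSpin N) (t : ℝ) : (blochMatrix t N).trace = 1 := by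
  simp [blochMatrix, Matrix.trace_add, Matrix.trace_smul, hN.trace_eq_zero]

theorem isHermitian_blochMatrix (hN : IsSpin N) (t : ℝ) : (blochMatrix t N).IsHermitian := by
  have := hN.isHermitian
  unfold Matrix.IsHermitian at *
  simp [blochMatrix, Matrix.conjTranspose_smul, this]

theorem isState (hN : IsSpin N) : IsState (blochMatrix 1 N) := by
  refine ⟨?_, hN.trace_blochMatrix 1⟩
  have h : blochMatrix 1 N = (blochMatrix 1 N).conjTranspose * blochMatrix 1 N := by
    rw [(hN.isHermitian_blochMatrix 1).eq]
    simp only [blochMatrix, Complex.ofReal_one, one_smul, Matrix.smul_mul, Matrix.mul_smul,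
      add_mul, mul_add, hN.mul_self, mul_one, one_mul]
    module
  rw [h]
  exact Matrix.posSemidef_conjTranspose_mul_self _

theorem sum_norm_sq_blochMatrix (hN : IsSpin N) (t : ℝ) :
    ∑ x, ∑ y, ‖blochMatrix t N x y‖ ^ 2 = (1 + t ^ 2) / 2 := by
  have h := sum_norm_sq_eq_trace (blochMatrix t N)
  rw [(hN.isHermitian_blochMatrix t).eq] at h
  have h2 : blochMatrix t N * blochMatrix t N =
      (4⁻¹ : ℂ) • ((1 + (t : ℂ) ^ 2) • (1 : Matrix (Fin 2) (Fin 2) ℂ) + (2 * (t : ℂ)) • N) := by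
    simp only [blochMatrix, Matrix.smul_mul, Matrix.mul_smul,
      add_mul, mul_add, hN.mul_self, mul_one, one_mul]
    module
  rw [h2, Matrix.trace_smul, Matrix.trace_add, Matrix.trace_smul, Matrix.trace_smul,
    hN.trace_eq_zero] at h
  have h3 : ((∑ x, ∑ y, ‖blochMatrix t N x y‖ ^ 2 : ℝ) : ℂ) = (((1 + t ^ 2) / 2 : ℝ) : ℂ) := by
    rw [h]
    simp only [Matrix.trace_one, Fintype.card_fin, smul_eq_mul]
    push_cast
    ring
  exact_mod_cast h3

theorem neg (hN : IsSpin N) : IsSpin (-N) :=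
  ⟨hN.isHermitian.neg, by simp [hN.mul_self], by simp [hN.trace_eq_zero]⟩

/-- Tracelessness excludes `N = -1`, and `N` fixes the range of `N + 1`. -/
theorem exists_eigenvector_one (hN : IsSpin N) : ∃ v : Fin 2 → ℂ, v ≠ 0 ∧ N.mulVec v = v := by
  have hne : N + 1 ≠ 0 := by
    intro h
    have := congrArg Matrix.trace h
    simp [Matrix.trace_add, hN.trace_eq_zero] at this
  obtain ⟨u, hu⟩ : ∃ u : Fin 2 → ℂ, (N + 1).mulVec u ≠ 0 := by
    by_contra! h
    exact hne (Matrix.ext_of_mulVec_single fun i => by rw [h, Matrix.zero_mulVec])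
  refine ⟨_, hu, ?_⟩
  rw [Matrix.mulVec_mulVec, mul_add, hN.mul_self, mul_one, add_comm]

/-- Choosing the eigenvector of `N` or of `-N` by the sign of `t` always selects the larger
eigenvalue, so that these eigenvalues multiply without cancellation in a tensor product. -/
theorem exists_eigenvector (hN : IsSpin N) (t : ℝ) : ∃ v : Fin 2 → ℂ, v ≠ 0 ∧
    (blochMatrix t N).mulVec v = (((1 + |t|) / 2 : ℝ) : ℂ) • v := by
  have key : ∀ (M : Matrix (Fin 2) (Fin 2) ℂ) (s : ℝ) (v : Fin 2 → ℂ), M.mulVec v = v →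
      (blochMatrix s M).mulVec v = (((1 + s) / 2 : ℝ) : ℂ) • v := by
    intro M s v h
    simp only [blochMatrix, Matrix.smul_mulVec, Matrix.add_mulVec, Matrix.one_mulVec, h]
    push_cast
    module
  rcases le_total 0 t with ht | ht
  · obtain ⟨v, hv, h⟩ := hN.exists_eigenvector_one
    exact ⟨v, hv, by rw [abs_of_nonneg ht]; exact key N t v h⟩
  · obtain ⟨v, hv, h⟩ := hN.neg.exists_eigenvector_one
    refine ⟨v, hv, ?_⟩
    have e : blochMatrix t N = blochMatrix (-t) (-N) := by simp [blochMatrix]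
    rw [abs_of_nonpos ht, e]
    exact key _ _ v h

end IsSpin

/-- Some state is encrypted into an operator whose Bloch vector has length `m`. -/
def EncryptionScheme.Attains (S : EncryptionScheme (Fin 2)) (m : ℝ) : Prop :=
  ∃ ξ, IsState ξ ∧ ∃ N, IsSpin N ∧ ∃ t : ℝ, |t| = m ∧ S.encrypt ξ = blochMatrix t N

theorem EncryptionScheme.Attains.nonneg {S : EncryptionScheme (Fin 2)} {m : ℝ}
    (h : S.Attains m) : 0 ≤ m := by
  obtain ⟨-, -, -, -, t, rfl, -⟩ := h
  exact abs_nonneg t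

/-- One product state serves both norms. The output is again a product, so its purity is `∏ (1 + m i
^ 2) / 2`, and the product of the top eigenvectors is an eigenvector with eigenvalue `∏ (1 + m i) /
2`. -/
theorem exists_product_state {n : ℕ} {S : Fin n → EncryptionScheme (Fin 2)} {m : Fin n → ℝ}
    (h : ∀ i, (S i).Attains (m i)) :
    ∃ ξ : Fin n → Matrix (Fin 2) (Fin 2) ℂ, (∀ i, IsState (ξ i)) ∧
      (tensorScheme S).distMixed .two (tensorMatrix ξ) ^ 2 =
        (∏ i, (1 + m i ^ 2) - 1) / 2 ^ n ∧
      (∏ i, (1 + m i) - 1) / 2 ^ n ≤ (tensorScheme S).distMixed .infty (tensorMatrix ξ) := by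
  choose ξ hξ N hN t ht hE using h
  have hcard : Fintype.card (Fin n → Fin 2) = 2 ^ n := by simp
  have hout : (tensorScheme S).encrypt (tensorMatrix ξ) =
      tensorMatrix fun i => blochMatrix (t i) (N i) := by
    rw [tensorScheme_encrypt, funext hE]
  refine ⟨ξ, hξ, ?_, ?_⟩
  · rw [EncryptionScheme.distMixed, hout, schattenNorm_two_sub_sq, sum_norm_sq_tensorMatrix]
    · simp_rw [fun i => (hN i).sum_norm_sq_blochMatrix (t i), ← ht, sq_abs]
      rw [Finset.prod_div_distrib, hcard]
      simp only [Finset.prod_const, Finset.card_univ, Fintype.card_fin]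
      push_cast
      rw [sub_div, one_div]
    · rw [tensorMatrix_trace]
      exact Finset.prod_eq_one fun i _ => (hN i).trace_blochMatrix (t i)
  · choose v hv hev using fun i => (hN i).exists_eigenvector (t i)
    rw [EncryptionScheme.distMixed, hout, hcard]
    refine (le_abs_self _).trans (le_schattenNorm_infty (v := fun x => ∏ i, v i (x i)) ?_ ?_)
    · choose x hx using fun i => Function.ne_iff.mp (hv i)
      exact Function.ne_iff.mpr ⟨x, Finset.prod_ne_zero_iff.mpr fun i _ => hx i⟩
    · rw [Matrix.sub_mulVec, tensorMatrix_mulVec, Matrix.smul_mulVec, Matrix.one_mulVec]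
      ext x
      simp only [hev, Pi.sub_apply, Pi.smul_apply, smul_eq_mul, Finset.prod_mul_distrib, ← ht]
      rw [← sub_mul]
      congr 1
      push_cast
      rw [Finset.prod_div_distrib]
      simp [sub_div]

theorem EncryptionScheme.Attains.le_of_errorLe {S : EncryptionScheme (Fin 2)} {m : ℝ}
    (h : S.Attains m) {ν : NormIndex} {ε : ℝ} (hε : S.ErrorLe ν ε) : m ≤ ε := by
  obtain ⟨ξ, hξ, N, hN, t, rfl, hE⟩ := h
  have h1 := hε ξ hξ
  rw [EncryptionScheme.distMixed, hE] at h1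
  have hcard : (Fintype.card (Fin 2) : ℝ) = 2 := by simp
  cases ν
  · have h2 : schattenNorm .two (blochMatrix t N -
        ((Fintype.card (Fin 2) : ℂ)⁻¹) • (1 : Matrix (Fin 2) (Fin 2) ℂ)) ^ 2 = (|t| / √2) ^ 2 := by
      rw [schattenNorm_two_sub_sq (hN.trace_blochMatrix t), hN.sum_norm_sq_blochMatrix, hcard,
        div_pow, Real.sq_sqrt (by norm_num), sq_abs]
      ring
    have h3 := (sq_eq_sq₀ (schattenNorm_nonneg _ _) (by positivity)).mp h2
    rw [h3, NormIndex.scale, hcard] at h1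
    exact (div_le_div_iff_of_pos_right (by positivity)).mp h1
  · obtain ⟨v, hv, hev⟩ := hN.exists_eigenvector t
    have h2 : (blochMatrix t N -
        ((Fintype.card (Fin 2) : ℂ)⁻¹) • (1 : Matrix (Fin 2) (Fin 2) ℂ)).mulVec v =
        ((|t| / 2 : ℝ) : ℂ) • v := by
      rw [Matrix.sub_mulVec, hev, Matrix.smul_mulVec, Matrix.one_mulVec, Fintype.card_fin]
      push_cast
      module
    have h3 := (le_abs_self _).trans (le_schattenNorm_infty hv h2)
    have h4 := h3.trans h1
    rw [NormIndex.scale, hcard] at h4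
    exact (div_le_div_iff_of_pos_right (by positivity)).mp h4

/-! ### Pauli matrices, Pauli strings and their scaling factors -/

/-- The sign with which `pauli s` changes under conjugation by `pauli k`. -/
def pauliSign (k s : Fin 4) : ℝ := if k = 0 ∨ s = 0 ∨ k = s then 1 else -1

/-- The factor by which the Pauli scheme with weights `p` scales `pauli s`. -/
noncomputable def pauliFactor (p : Fin 4 → ℝ) (s : Fin 4) : ℝ := ∑ k, p k * pauliSign k s

theorem pauli_isHermitian (s : Fin 4) : (pauli s).IsHermitian := by
  ext i j
  fin_cases s <;> fin_cases i <;> fin_cases j <;> simp [pauli]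

theorem pauli_conj (k s : Fin 4) :
    pauli k * pauli s * (pauli k).conjTranspose = (pauliSign k s : ℂ) • pauli s := by
  ext i j
  fin_cases k <;> fin_cases s <;> fin_cases i <;> fin_cases j <;>
    simp [pauli, pauliSign, Matrix.mul_apply, Fin.sum_univ_two]

theorem pauli_zero : pauli 0 = 1 := by
  ext i j
  fin_cases i <;> fin_cases j <;> simp [pauli]

theorem pauli_isSpin {s : Fin 4} (hs : s ≠ 0) : IsSpin (pauli s) := by
  refine ⟨pauli_isHermitian s, ?_, ?_⟩
  · have := Matrix.mem_unitaryGroup_iff.mp (pauli_mem_unitaryGroup s)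
    rwa [Matrix.star_eq_conjTranspose, (pauli_isHermitian s).eq] at this
  · fin_cases s <;> simp [pauli, Matrix.trace, Fin.sum_univ_two] at hs ⊢

theorem pauli_trace_mul (s t : Fin 4) : (pauli s * pauli t).trace = if s = t then 2 else 0 := by
  fin_cases s <;> fin_cases t <;>
    norm_num [pauli, Matrix.trace, Matrix.mul_apply, Fin.sum_univ_two]

theorem pauli_completeness (a b c d : Fin 2) :
    ∑ s, pauli s a b * pauli s c d = if a = d ∧ b = c then 2 else 0 := by
  fin_cases a <;> fin_cases b <;> fin_cases c <;> fin_cases d <;>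
    simp [pauli, Fin.sum_univ_four] <;> norm_num

theorem pauliScheme_encrypt_pauli (p : stdSimplex ℝ (Fin 4)) (s : Fin 4) :
    (pauliScheme p).encrypt (pauli s) = (pauliFactor p.1 s : ℂ) • pauli s := by
  have : (pauliScheme p).encrypt (pauli s) =
      ∑ k, (p.1 k : ℂ) • (pauli k * pauli s * (pauli k).conjTranspose) := rfl
  rw [this]
  simp_rw [pauli_conj, smul_smul, ← Finset.sum_smul, pauliFactor]
  push_cast
  rfl

theorem pauliFactor_zero (p : stdSimplex ℝ (Fin 4)) : pauliFactor p.1 0 = 1 := by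
  simp [pauliFactor, pauliSign, p.2.2]

namespace EncryptionScheme

variable {d : Type} [Fintype d] [DecidableEq d] (S : EncryptionScheme d)

theorem encrypt_smul (c : ℂ) (A : Matrix d d ℂ) : S.encrypt (c • A) = c • S.encrypt A := by
  simp only [encrypt, Matrix.mul_smul, Matrix.smul_mul, Finset.smul_sum, smul_comm c]

theorem encrypt_add (A B : Matrix d d ℂ) : S.encrypt (A + B) = S.encrypt A + S.encrypt B := by
  simp only [encrypt, mul_add, add_mul, smul_add, Finset.sum_add_distrib]

theorem encrypt_sum {ι : Type*} (s : Finset ι) (A : ι → Matrix d d ℂ) :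
    S.encrypt (∑ i ∈ s, A i) = ∑ i ∈ s, S.encrypt (A i) := by
  classical
  induction s using Finset.induction_on with
  | empty => simp [encrypt]
  | insert a s ha ih => rw [Finset.sum_insert ha, Finset.sum_insert ha, encrypt_add, ih]

theorem encrypt_isHermitian {A : Matrix d d ℂ} (hA : A.IsHermitian) :
    (S.encrypt A).IsHermitian := by
  unfold Matrix.IsHermitian at *
  simp [encrypt, Matrix.conjTranspose_sum, Matrix.conjTranspose_smul, Matrix.conjTranspose_mul,
    hA, mul_assoc]

end EncryptionScheme

/-- The tensor product of Pauli matrices. -/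
noncomputable def pauliString {n : ℕ} (s : Fin n → Fin 4) :
    Matrix (Fin n → Fin 2) (Fin n → Fin 2) ℂ :=
  tensorMatrix fun i => pauli (s i)

theorem tensorMatrix_smul {n : ℕ} (c : Fin n → ℂ) (A : Fin n → Matrix (Fin 2) (Fin 2) ℂ) :
    (tensorMatrix fun i => c i • A i) = (∏ i, c i) • tensorMatrix A := by
  ext x y
  simp [tensorMatrix, Finset.prod_mul_distrib]

theorem pauliString_zero {n : ℕ} : pauliString (0 : Fin n → Fin 4) = 1 := by
  simp only [pauliString, Pi.zero_apply, pauli_zero, tensorMatrix_one]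

theorem pauliString_isHermitian {n : ℕ} (s : Fin n → Fin 4) : (pauliString s).IsHermitian := by
  have := tensorMatrix_star fun i => pauli (s i)
  simp_rw [Matrix.star_eq_conjTranspose, (pauli_isHermitian _).eq] at this
  exact this

theorem pauliString_trace_mul {n : ℕ} (s t : Fin n → Fin 4) :
    (pauliString s * pauliString t).trace = if s = t then 2 ^ n else 0 := by
  rw [pauliString, pauliString, tensorMatrix_mul, tensorMatrix_trace]
  simp_rw [pauli_trace_mul]
  split_ifs with h
  · subst h; simp
  · obtain ⟨i, hi⟩ := Function.ne_iff.mp h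
    exact Finset.prod_eq_zero (Finset.mem_univ i) (if_neg hi)

theorem pauliString_completeness {n : ℕ} (u v x y : Fin n → Fin 2) :
    ∑ s, pauliString s u v * pauliString s x y = if u = y ∧ v = x then 2 ^ n else 0 := by
  have : ∑ s, pauliString s u v * pauliString s x y =
      ∏ i, ∑ j, pauli j (u i) (v i) * pauli j (x i) (y i) := by
    rw [Finset.prod_univ_sum, Fintype.piFinset_univ]
    simp [pauliString, tensorMatrix, Finset.prod_mul_distrib]
  rw [this]
  simp_rw [pauli_completeness]
  split_ifs with h
  · obtain ⟨rfl, rfl⟩ := h; simp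
  · have : ∃ i, ¬ (u i = y i ∧ v i = x i) := by
      by_contra! h'
      exact h ⟨funext fun i => (h' i).1, funext fun i => (h' i).2⟩
    obtain ⟨i, hi⟩ := this
    exact Finset.prod_eq_zero (Finset.mem_univ i) (if_neg hi)

/-- Completeness of the Pauli strings is their orthogonality read in the other index, and yields the
expansion entry by entry. -/
theorem pauliString_expansion {n : ℕ} (A : Matrix (Fin n → Fin 2) (Fin n → Fin 2) ℂ) :
    A = ((2 : ℂ) ^ n)⁻¹ • ∑ s, (pauliString s * A).trace • pauliString s := by
  ext x y
  have h : (∑ s, (pauliString s * A).trace • pauliString s) x y = 2 ^ n * A x y := by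
    simp only [Matrix.sum_apply, Matrix.smul_apply, smul_eq_mul, Matrix.trace, Matrix.diag_apply,
      Matrix.mul_apply, Finset.sum_mul]
    rw [Finset.sum_comm]
    simp_rw [fun u => Finset.sum_comm (s := (Finset.univ : Finset (Fin n → Fin 4)))
      (t := (Finset.univ : Finset (Fin n → Fin 2)))
      (f := fun s v => pauliString s u v * A v u * pauliString s x y),
      mul_right_comm _ (A _ _), ← Finset.sum_mul, pauliString_completeness]
    rw [Finset.sum_eq_single y, Finset.sum_eq_single x]
    · simp
    · intro b _ hb; simp [hb]
    · simp
    · intro b _ hb; simp [hb]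
    · simp
  rw [Matrix.smul_apply, h, smul_eq_mul, inv_mul_cancel_left₀ (by positivity)]

theorem sum_norm_sq_pauliString {n : ℕ} (b : (Fin n → Fin 4) → ℂ) :
    ∑ x, ∑ y, ‖(∑ s, b s • pauliString s) x y‖ ^ 2 = 2 ^ n * ∑ s, ‖b s‖ ^ 2 := by
  have h := sum_norm_sq_eq_trace (∑ s, b s • pauliString s)
  have h2 : ((∑ s, b s • pauliString s) * (∑ s, b s • pauliString s).conjTranspose).trace =
      ((2 ^ n * ∑ s, ‖b s‖ ^ 2 : ℝ) : ℂ) := by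
    simp only [Matrix.conjTranspose_sum, Matrix.conjTranspose_smul, (pauliString_isHermitian _).eq,
      Finset.sum_mul_sum, Matrix.trace_sum, Matrix.smul_mul, Matrix.mul_smul, Matrix.trace_smul,
      pauliString_trace_mul, smul_eq_mul, mul_ite, mul_zero, Finset.sum_ite_eq, Finset.mem_univ,
      if_true]
    push_cast
    rw [Finset.mul_sum]
    refine Finset.sum_congr rfl fun s _ => ?_
    rw [← Complex.mul_conj']
    simp only [starRingEnd_apply]
    ring
  rw [h2] at h
  exact_mod_cast h

theorem pauliPower_encrypt_pauliString {n : ℕ} (p : stdSimplex ℝ (Fin 4)) (s : Fin n → Fin 4) :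
    (pauliPower p n).encrypt (pauliString s) =
      ((∏ i, pauliFactor p.1 (s i) : ℝ) : ℂ) • pauliString s := by
  rw [pauliPower, pauliString, tensorScheme_encrypt]
  simp_rw [pauliScheme_encrypt_pauli, tensorMatrix_smul]
  push_cast
  rfl

/-- The coefficients of the Pauli strings in the difference of `pauliPower` and the completely
depolarizing map. -/
noncomputable def pauliDeviation {n : ℕ} (p : Fin 4 → ℝ) (s : Fin n → Fin 4) : ℝ :=
  (∏ i, pauliFactor p (s i)) - if s = 0 then 1 else 0

theorem pauliDeviation_zero {n : ℕ} (p : stdSimplex ℝ (Fin 4)) :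
    pauliDeviation p.1 (0 : Fin n → Fin 4) = 0 := by
  simp [pauliDeviation, pauliFactor_zero]

theorem pauliPower_encrypt_sub {n : ℕ} (p : stdSimplex ℝ (Fin 4))
    {ρ : Matrix (Fin n → Fin 2) (Fin n → Fin 2) ℂ} (hρ : ρ.trace = 1) :
    (pauliPower p n).encrypt ρ - ((Fintype.card (Fin n → Fin 2) : ℂ)⁻¹) • 1 =
      ∑ s, (((2 : ℂ) ^ n)⁻¹ * (pauliDeviation p.1 s : ℂ) *
        (pauliString s * ρ).trace) • pauliString s := by
  have h1 : (pauliPower p n).encrypt ρ = ∑ s, (((2 : ℂ) ^ n)⁻¹ *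
      ((∏ i, pauliFactor p.1 (s i) : ℝ) : ℂ) * (pauliString s * ρ).trace) • pauliString s := by
    conv_lhs => rw [pauliString_expansion ρ]
    rw [EncryptionScheme.encrypt_smul, EncryptionScheme.encrypt_sum, Finset.smul_sum]
    refine Finset.sum_congr rfl fun s _ => ?_
    rw [EncryptionScheme.encrypt_smul, pauliPower_encrypt_pauliString, smul_smul, smul_smul]
    congr 1
    ring
  have h2 : ((Fintype.card (Fin n → Fin 2) : ℂ)⁻¹) •
      (1 : Matrix (Fin n → Fin 2) (Fin n → Fin 2) ℂ) =
      ∑ s : Fin n → Fin 4, (((2 : ℂ) ^ n)⁻¹ * ((if s = 0 then 1 else 0 : ℝ) : ℂ) *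
        (pauliString s * ρ).trace) • pauliString s := by
    rw [Finset.sum_eq_single 0]
    · simp [pauliString_zero, hρ]
    · intro s _ hs; simp [hs]
    · simp
  rw [h1, h2, ← Finset.sum_sub_distrib]
  refine Finset.sum_congr rfl fun s _ => ?_
  rw [← sub_smul]
  congr 1
  rw [pauliDeviation]
  push_cast
  ring

/-! ### Purity of a state under local depolarizing noise -/

/-- Writing `ρ = B† B`, each term of the double sum is bounded by AM-GM. The pairing is deliberate:
`v` goes with `u'` and `u` with `v'`, because these are the pairs over which `pauliKernel` has
constant marginals. -/
theorem Matrix.PosSemidef.two_mul_re_mul_le {d : Type} [Fintype d] {ρ : Matrix d d ℂ}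
    (h : ρ.PosSemidef) (v u u' v' : d) :
    2 * (ρ v u * ρ u' v').re ≤
      (ρ v v).re * (ρ u' u').re + (ρ u u).re * (ρ v' v').re := by
  classical
  obtain ⟨B, rfl⟩ : ∃ B : Matrix d d ℂ, ρ = star B * B := by
    open scoped MatrixOrder in
    exact CStarAlgebra.nonneg_iff_eq_star_mul_self.mp h.nonneg
  have hd : ∀ x, ((star B * B) x x).re = ∑ z, ‖B z x‖ ^ 2 := by
    intro x
    simp only [Matrix.mul_apply, Matrix.star_apply, Complex.re_sum]
    refine Finset.sum_congr rfl fun z _ => ?_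
    rw [← starRingEnd_apply, mul_comm, Complex.mul_conj']
    norm_cast
  simp only [hd, Finset.sum_mul_sum, ← Finset.sum_add_distrib]
  rw [Matrix.mul_apply, Matrix.mul_apply, Finset.sum_mul_sum, Complex.re_sum, Finset.mul_sum]
  refine Finset.sum_le_sum fun z _ => ?_
  rw [Complex.re_sum, Finset.mul_sum]
  refine Finset.sum_le_sum fun w _ => ?_
  rw [Matrix.star_apply, Matrix.star_apply]
  have h1 : (star (B z v) * B z u * (star (B w u') * B w v')).re ≤
      (‖B z v‖ * ‖B w u'‖) * (‖B z u‖ * ‖B w v'‖) := by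
    refine (Complex.re_le_norm _).trans (le_of_eq ?_)
    simp only [norm_mul, norm_star]
    ring
  nlinarith [sq_nonneg (‖B z v‖ * ‖B w u'‖ - ‖B z u‖ * ‖B w v'‖)]

/-- The weight `η ^ |s|`, where `|s|` is the number of qubits on which `s` acts nontrivially. -/
noncomputable def pauliWeight {n : ℕ} (η : ℝ) (s : Fin n → Fin 4) : ℝ :=
  ∏ i, if s i = 0 then 1 else η

/-- The entries of `∑ s, η ^ |s| • σ_s ⊗ σ_s` for a single qubit. -/
noncomputable def pauliKernel (η : ℝ) (a b c d : Fin 2) : ℝ :=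
  (if a = b ∧ c = d then 1 - η else 0) + if a = c ∧ b = d then 2 * η else 0

theorem pauliKernel_eq (η : ℝ) (a b c d : Fin 2) :
    ∑ j, ((if j = 0 then 1 else η : ℝ) : ℂ) * (pauli j a b * star (pauli j c d)) =
      pauliKernel η a b c d := by
  fin_cases a <;> fin_cases b <;> fin_cases c <;> fin_cases d <;>
    simp [pauli, pauliKernel, Fin.sum_univ_four] <;> ring

theorem pauliKernel_nonneg {η : ℝ} (h0 : 0 ≤ η) (h1 : η ≤ 1) (a b c d : Fin 2) :
    0 ≤ pauliKernel η a b c d := by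
  unfold pauliKernel
  split_ifs <;> linarith

theorem sum_pauliKernel_inner (η : ℝ) (a d : Fin 2) :
    ∑ b, ∑ c, pauliKernel η a b c d = 1 + η := by
  fin_cases a <;> fin_cases d <;> norm_num [pauliKernel, Fin.sum_univ_two] <;> ring

theorem sum_pauliKernel_outer (η : ℝ) (b c : Fin 2) :
    ∑ a, ∑ d, pauliKernel η a b c d = 1 + η := by
  fin_cases b <;> fin_cases c <;> norm_num [pauliKernel, Fin.sum_univ_two] <;> ring

theorem prod_sum_sum {n : ℕ} (f : Fin n → Fin 2 → Fin 2 → ℝ) :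
    ∏ i, ∑ a, ∑ b, f i a b =
      ∑ x : Fin n → Fin 2, ∑ y : Fin n → Fin 2, ∏ i, f i (x i) (y i) := by
  rw [Finset.prod_univ_sum, Fintype.piFinset_univ]
  refine Finset.sum_congr rfl fun x _ => ?_
  rw [Finset.prod_univ_sum, Fintype.piFinset_univ]

theorem sum_pauliWeight_eq {n : ℕ} (η : ℝ) (ρ : Matrix (Fin n → Fin 2) (Fin n → Fin 2) ℂ) :
    ((∑ s, pauliWeight η s * ‖(pauliString s * ρ).trace‖ ^ 2 : ℝ) : ℂ) =
      ∑ u, ∑ v, ∑ u', ∑ v', ((∏ i, pauliKernel η (u i) (v i) (u' i) (v' i) : ℝ) : ℂ) *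
        (ρ v u * star (ρ v' u')) := by
  have h1 : ∀ s : Fin n → Fin 4, (((pauliWeight η s * ‖(pauliString s * ρ).trace‖ ^ 2 : ℝ)) : ℂ) =
      ∑ u, ∑ v, ∑ u', ∑ v', (∏ i, ((if s i = 0 then 1 else η : ℝ) : ℂ) *
        (pauli (s i) (u i) (v i) * star (pauli (s i) (u' i) (v' i)))) *
        (ρ v u * star (ρ v' u')) := by
    intro s
    push_cast
    rw [← Complex.conj_mul', Matrix.trace]
    simp only [Matrix.diag_apply, Matrix.mul_apply, map_sum, Finset.sum_mul, Finset.mul_sum]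
    refine Finset.sum_congr rfl fun u _ => Finset.sum_congr rfl fun v _ =>
      Finset.sum_congr rfl fun u' _ => Finset.sum_congr rfl fun v' _ => ?_
    simp only [Finset.prod_mul_distrib, pauliWeight, pauliString, tensorMatrix, Matrix.of_apply,
      map_mul, map_prod, starRingEnd_apply]
    push_cast
    ring
  rw [Complex.ofReal_sum]
  simp_rw [h1]
  rw [Finset.sum_comm]
  refine Finset.sum_congr rfl fun u _ => ?_
  rw [Finset.sum_comm]
  refine Finset.sum_congr rfl fun v _ => ?_
  rw [Finset.sum_comm]
  refine Finset.sum_congr rfl fun u' _ => ?_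
  rw [Finset.sum_comm]
  refine Finset.sum_congr rfl fun v' _ => ?_
  rw [← Finset.sum_mul]
  congr 1
  push_cast
  simp_rw [← pauliKernel_eq]
  rw [Finset.prod_univ_sum, Fintype.piFinset_univ]

theorem IsState.sum_re_diag {d : Type} [Fintype d] {ρ : Matrix d d ℂ} (h : IsState ρ) :
    ∑ x, (ρ x x).re = 1 := by
  have := congrArg Complex.re h.2
  simpa [Matrix.trace] using this

/-- The purity of a state after depolarizing noise on each qubit is largest for product states. -/
theorem IsState.sum_pauliWeight_le {n : ℕ} {η : ℝ} (h0 : 0 ≤ η) (h1 : η ≤ 1)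
    {ρ : Matrix (Fin n → Fin 2) (Fin n → Fin 2) ℂ} (hρ : IsState ρ) :
    ∑ s, pauliWeight η s * ‖(pauliString s * ρ).trace‖ ^ 2 ≤ (1 + η) ^ n := by
  -- The sum is a quadratic expression in the entries of `ρ` whose coefficients `K` are nonnegative
  -- because `η ≤ 1`. Hence the entrywise inequality for positive semidefinite matrices may be
  -- applied term by term.
  set K : (Fin n → Fin 2) → (Fin n → Fin 2) → (Fin n → Fin 2) → (Fin n → Fin 2) → ℝ :=
    fun u v u' v' => ∏ i, pauliKernel η (u i) (v i) (u' i) (v' i) with hK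
  have hK0 : ∀ u v u' v', 0 ≤ K u v u' v' := fun u v u' v' =>
    Finset.prod_nonneg fun i _ => pauliKernel_nonneg h0 h1 _ _ _ _
  have hre : ∑ s, pauliWeight η s * ‖(pauliString s * ρ).trace‖ ^ 2 =
      ∑ u, ∑ v, ∑ u', ∑ v', K u v u' v' * (ρ v u * ρ u' v').re := by
    have h := congrArg Complex.re (sum_pauliWeight_eq η ρ)
    rw [Complex.ofReal_re] at h
    rw [h]
    simp only [Complex.re_sum, Complex.re_ofReal_mul]
    refine Finset.sum_congr rfl fun u _ => Finset.sum_congr rfl fun v _ =>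
      Finset.sum_congr rfl fun u' _ => Finset.sum_congr rfl fun v' _ => ?_
    rw [← hρ.1.1.apply v' u', star_star]
  -- Both marginals of `K` are constant, so after the termwise bound only `(tr ρ)² = 1` is left in
  -- each half.
  have hin : ∀ u v', ∑ v, ∑ u', K u v u' v' = (1 + η) ^ n := by
    intro u v'
    rw [hK, ← prod_sum_sum fun i a b => pauliKernel η (u i) a b (v' i)]
    simp only [sum_pauliKernel_inner]
    simp
  have hout : ∀ v u', ∑ u, ∑ v', K u v u' v' = (1 + η) ^ n := by
    intro v u'
    rw [hK, ← prod_sum_sum fun i a b => pauliKernel η a (v i) (u' i) b]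
    simp only [sum_pauliKernel_outer]
    simp
  have hA : ∑ u, ∑ v, ∑ u', ∑ v', K u v u' v' * ((ρ v v).re * (ρ u' u').re) = (1 + η) ^ n := by
    calc _ = ∑ v, ∑ u', (∑ u, ∑ v', K u v u' v') * ((ρ v v).re * (ρ u' u').re) := by
          rw [Finset.sum_comm]
          refine Finset.sum_congr rfl fun v _ => ?_
          rw [Finset.sum_comm]
          simp_rw [Finset.sum_mul]
      _ = _ := by
          simp_rw [hout, ← Finset.mul_sum, hρ.sum_re_diag, mul_one, hρ.sum_re_diag, mul_one]
  have hB : ∑ u, ∑ v, ∑ u', ∑ v', K u v u' v' * ((ρ u u).re * (ρ v' v').re) = (1 + η) ^ n := by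
    calc _ = ∑ u, ∑ v', (∑ v, ∑ u', K u v u' v') * ((ρ u u).re * (ρ v' v').re) := by
          refine Finset.sum_congr rfl fun u _ => ?_
          simp_rw [Finset.sum_mul]
          exact (Finset.sum_congr rfl fun v _ => Finset.sum_comm).trans Finset.sum_comm
      _ = _ := by
          simp_rw [hin, ← Finset.mul_sum, hρ.sum_re_diag, mul_one, hρ.sum_re_diag, mul_one]
  have hle : ∑ u, ∑ v, ∑ u', ∑ v', K u v u' v' * (2 * (ρ v u * ρ u' v').re) ≤
      ∑ u, ∑ v, ∑ u', ∑ v', (K u v u' v' * ((ρ v v).re * (ρ u' u').re) +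
        K u v u' v' * ((ρ u u).re * (ρ v' v').re)) := by
    refine Finset.sum_le_sum fun u _ => Finset.sum_le_sum fun v _ =>
      Finset.sum_le_sum fun u' _ => Finset.sum_le_sum fun v' _ => ?_
    rw [← mul_add]
    exact mul_le_mul_of_nonneg_left (hρ.1.two_mul_re_mul_le v u u' v') (hK0 _ _ _ _)
  simp only [Finset.sum_add_distrib, hA, hB, mul_left_comm _ (2 : ℝ), ← Finset.mul_sum] at hle
  rw [hre]
  linarith

/-- The identity string contributes exactly `(tr ρ)² = 1` to the full sum; dropping it produces the
`- 1`. -/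
theorem IsState.sum_mul_norm_sq_le {n : ℕ} {η : ℝ} (h0 : 0 ≤ η) (h1 : η ≤ 1)
    {ρ : Matrix (Fin n → Fin 2) (Fin n → Fin 2) ℂ} (hρ : IsState ρ) {c : (Fin n → Fin 4) → ℝ}
    (hc0 : c 0 = 0) (hc : ∀ s, c s ≤ pauliWeight η s) :
    ∑ s, c s * ‖(pauliString s * ρ).trace‖ ^ 2 ≤ (1 + η) ^ n - 1 := by
  have h2 : ∀ s : Fin n → Fin 4, c s * ‖(pauliString s * ρ).trace‖ ^ 2 ≤
      pauliWeight η s * ‖(pauliString s * ρ).trace‖ ^ 2 - if s = 0 then 1 else 0 := by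
    intro s
    split_ifs with hs
    · subst hs
      simp [hc0, pauliWeight, pauliString_zero, hρ.2]
    · rw [sub_zero]
      exact mul_le_mul_of_nonneg_right (hc s) (by positivity)
  refine (Finset.sum_le_sum fun s _ => h2 s).trans ?_
  rw [Finset.sum_sub_distrib, Finset.sum_ite_eq']
  simpa using hρ.sum_pauliWeight_le h0 h1

/-! ### Upper bounds for tensor powers of a Pauli scheme -/

section PauliPowerBounds

variable {n : ℕ} {p : stdSimplex ℝ (Fin 4)} {m : ℝ}

theorem abs_prod_pauliFactor_le (hm : ∀ s, s ≠ 0 → |pauliFactor p.1 s| ≤ m)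
    (s : Fin n → Fin 4) : |∏ i, pauliFactor p.1 (s i)| ≤ pauliWeight m s := by
  rw [Finset.abs_prod]
  refine Finset.prod_le_prod (fun i _ => abs_nonneg _) fun i _ => ?_
  split_ifs with h
  · rw [h, pauliFactor_zero, abs_one]
  · exact hm _ h

theorem abs_pauliDeviation_le (hm : ∀ s, s ≠ 0 → |pauliFactor p.1 s| ≤ m)
    (s : Fin n → Fin 4) : |pauliDeviation p.1 s| ≤ pauliWeight m s := by
  by_cases hs : s = 0
  · simp [hs, pauliDeviation_zero, pauliWeight]
  · simp only [pauliDeviation, hs, if_false, sub_zero]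
    exact abs_prod_pauliFactor_le hm s

theorem pauliPower_distMixed_two_le (hm1 : m ≤ 1) (hm : ∀ s, s ≠ 0 → |pauliFactor p.1 s| ≤ m)
    {ρ : Matrix (Fin n → Fin 2) (Fin n → Fin 2) ℂ} (hρ : IsState ρ) :
    (pauliPower p n).distMixed .two ρ ^ 2 ≤ ((1 + m ^ 2) ^ n - 1) / 2 ^ n := by
  have hm0 : 0 ≤ m := (abs_nonneg _).trans (hm 1 (by decide))
  rw [EncryptionScheme.distMixed, pauliPower_encrypt_sub p hρ.2, schattenNorm_two_sq,
    sum_norm_sq_pauliString]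
  -- Squaring the coefficients turns the weight `m ^ |s|` into `(m ^ 2) ^ |s|`, so the purity bound
  -- enters with `η = m ^ 2`.
  have h2 : ∑ s, pauliDeviation p.1 s ^ 2 * ‖(pauliString s * ρ).trace‖ ^ 2 ≤ (1 + m ^ 2) ^ n - 1 := by
    refine hρ.sum_mul_norm_sq_le (sq_nonneg m) (pow_le_one₀ hm0 hm1) ?_ fun s => ?_
    · simp [pauliDeviation_zero]
    · have hw : pauliWeight (m ^ 2) s = pauliWeight m s ^ 2 := by
        rw [pauliWeight, pauliWeight, ← Finset.prod_pow]
        exact Finset.prod_congr rfl fun i _ => by split_ifs <;> simp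
      rw [hw, ← sq_abs]
      exact pow_le_pow_left₀ (abs_nonneg _) (abs_pauliDeviation_le hm s) 2
  have h3 : ∀ s, ‖((2 : ℂ) ^ n)⁻¹ * (pauliDeviation p.1 s : ℂ) * (pauliString s * ρ).trace‖ ^ 2 =
      ((2 ^ n)⁻¹) ^ 2 * (pauliDeviation p.1 s ^ 2 * ‖(pauliString s * ρ).trace‖ ^ 2) := by
    intro s
    rw [norm_mul, norm_mul, mul_pow, mul_pow, Complex.norm_real, Real.norm_eq_abs, sq_abs]
    simp
    ring
  simp_rw [h3, ← Finset.mul_sum]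
  rw [← mul_assoc, div_eq_inv_mul]
  have : (2 : ℝ) ^ n * ((2 ^ n)⁻¹) ^ 2 = (2 ^ n)⁻¹ := by field_simp
  rw [this]
  exact mul_le_mul_of_nonneg_left h2 (by positivity)

theorem isState_vecMulVec {d : Type} [Fintype d] {v : d → ℂ} (hv : star v ⬝ᵥ v = 1) :
    IsState (Matrix.vecMulVec v (star v)) := by
  refine ⟨Matrix.posSemidef_vecMulVec_self_star v, ?_⟩
  rw [Matrix.trace_vecMulVec, dotProduct_comm, hv]

theorem pauliPower_distMixed_infty_le (hm1 : m ≤ 1) (hm : ∀ s, s ≠ 0 → |pauliFactor p.1 s| ≤ m)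
    {ρ : Matrix (Fin n → Fin 2) (Fin n → Fin 2) ℂ} (hρ : IsState ρ) :
    (pauliPower p n).distMixed .infty ρ ≤ ((1 + m) ^ n - 1) / 2 ^ n := by
  have hm0 : 0 ≤ m := (abs_nonneg _).trans (hm 1 (by decide))
  have h1 : (1 : ℝ) ≤ (1 + m) ^ n := one_le_pow₀ (by linarith)
  refine schattenNorm_infty_le ?_ (by have := sub_nonneg.mpr h1; positivity) fun v hv => ?_
  · refine (EncryptionScheme.encrypt_isHermitian _ hρ.1.1).sub ?_
    simp [Matrix.IsHermitian, Matrix.conjTranspose_smul]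
  -- The quadratic form at `v` pairs the Pauli coefficients of `ρ` with those of the pure state `ψ`.
  -- The inequality `2ab ≤ a² + b²` separates them, and the purity bound with `η = m` applies to
  -- both states.
  set ψ := Matrix.vecMulVec v (star v) with hψ
  have hψs : IsState ψ := isState_vecMulVec hv
  rw [pauliPower_encrypt_sub p hρ.2]
  have htr : ∀ s : Fin n → Fin 4, star v ⬝ᵥ (pauliString s).mulVec v =
      (pauliString s * ψ).trace := by
    intro s
    rw [hψ, Matrix.mul_vecMulVec, Matrix.trace_vecMulVec, dotProduct_comm]
  have hρb := hρ.sum_mul_norm_sq_le hm0 hm1 (c := fun s => |pauliDeviation p.1 s|)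
    (by simp [pauliDeviation_zero]) (abs_pauliDeviation_le hm)
  have hψb := hψs.sum_mul_norm_sq_le hm0 hm1 (c := fun s => |pauliDeviation p.1 s|)
    (by simp [pauliDeviation_zero]) (abs_pauliDeviation_le hm)
  have hexp : star v ⬝ᵥ (∑ s, (((2 : ℂ) ^ n)⁻¹ * (pauliDeviation p.1 s : ℂ) * (pauliString s * ρ).trace) •
      pauliString s).mulVec v = ∑ s, (((2 : ℂ) ^ n)⁻¹ * (pauliDeviation p.1 s : ℂ) * (pauliString s * ρ).trace) *
        (pauliString s * ψ).trace := by
    rw [Matrix.sum_mulVec, dotProduct_sum]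
    refine Finset.sum_congr rfl fun s _ => ?_
    rw [Matrix.smul_mulVec, dotProduct_smul, htr, smul_eq_mul]
  rw [hexp]
  refine (norm_sum_le _ _).trans ?_
  have h3 : ∀ s, ‖((2 : ℂ) ^ n)⁻¹ * (pauliDeviation p.1 s : ℂ) * (pauliString s * ρ).trace *
      (pauliString s * ψ).trace‖ ≤ (2 ^ n)⁻¹ * (1 / 2) *
      (|pauliDeviation p.1 s| * ‖(pauliString s * ρ).trace‖ ^ 2 + |pauliDeviation p.1 s| * ‖(pauliString s * ψ).trace‖ ^ 2) := by
    intro s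
    rw [norm_mul, norm_mul, norm_mul, Complex.norm_real, Real.norm_eq_abs]
    have : ‖((2 : ℂ) ^ n)⁻¹‖ = (2 ^ n)⁻¹ := by simp
    rw [this, mul_assoc, mul_assoc, mul_assoc]
    refine mul_le_mul_of_nonneg_left ?_ (by positivity)
    have := mul_nonneg (abs_nonneg (pauliDeviation p.1 s))
      (sq_nonneg (‖(pauliString s * ρ).trace‖ - ‖(pauliString s * ψ).trace‖))
    nlinarith
  refine (Finset.sum_le_sum fun s _ => h3 s).trans ?_
  rw [← Finset.mul_sum, Finset.sum_add_distrib, div_eq_inv_mul ((1 + m) ^ n - 1), mul_assoc]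
  have h4 : (0 : ℝ) ≤ (2 ^ n)⁻¹ := by positivity
  exact mul_le_mul_of_nonneg_left (by linarith) h4

end PauliPowerBounds

/-! ### Unit quaternions and orthonormal frames -/

/-- The matrix of the quaternion with coordinates `v`. -/
noncomputable def quatMatrix (v : Fin 4 → ℝ) : Matrix (Fin 2) (Fin 2) ℂ :=
  !![(v 0 : ℂ) + v 3 * Complex.I, (v 2 : ℂ) + v 1 * Complex.I;
    -(v 2 : ℂ) + v 1 * Complex.I, (v 0 : ℂ) - v 3 * Complex.I]

theorem quatMatrix_sum {ι : Type*} [Fintype ι] (c : ι → ℝ) (e : ι → Fin 4 → ℝ) :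
    quatMatrix (fun b => ∑ j, c j * e j b) = ∑ j, (c j : ℂ) • quatMatrix (e j) := by
  ext x y
  fin_cases x <;> fin_cases y <;>
    simp [quatMatrix, Matrix.sum_apply, mul_add, mul_sub, Finset.sum_add_distrib,
      Finset.sum_mul, mul_assoc]

/-- This is the polarization of `q q̄ = |q|²`: orthogonal quaternions satisfy an anticommutation
relation. -/
theorem quatMatrix_mul_conj_add (u v : Fin 4 → ℝ) :
    quatMatrix u * (quatMatrix v).conjTranspose + quatMatrix v * (quatMatrix u).conjTranspose =
      ((2 * ∑ a, u a * v a : ℝ) : ℂ) • 1 := by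
  ext x y
  fin_cases x <;> fin_cases y <;> apply Complex.ext <;>
    simp [quatMatrix, Fin.sum_univ_four, Matrix.vecMul, dotProduct] <;> ring

theorem quatMatrix_conj_mul_add (u v : Fin 4 → ℝ) :
    (quatMatrix u).conjTranspose * quatMatrix v + (quatMatrix v).conjTranspose * quatMatrix u =
      ((2 * ∑ a, u a * v a : ℝ) : ℂ) • 1 := by
  ext x y
  fin_cases x <;> fin_cases y <;> apply Complex.ext <;>
    simp [quatMatrix, Matrix.mul_apply, Fin.sum_univ_four] <;> ring

theorem quatMatrix_trace_mul_conj (u v : Fin 4 → ℝ) :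
    (quatMatrix u * (quatMatrix v).conjTranspose).trace = ((2 * ∑ a, u a * v a : ℝ) : ℂ) := by
  apply Complex.ext <;>
    simp [quatMatrix, Matrix.trace, Fin.sum_univ_four, Matrix.vecMul,
      dotProduct] <;> ring

theorem quatMatrix_mul_conj_self {v : Fin 4 → ℝ} (hv : ∑ a, v a * v a = 1) :
    quatMatrix v * (quatMatrix v).conjTranspose = 1 := by
  have h := quatMatrix_mul_conj_add v v
  rw [hv, ← two_smul ℂ] at h
  have := congrArg (fun A => (2⁻¹ : ℂ) • A) h
  simpa [smul_smul] using this

theorem quatMatrix_conj_mul_self {v : Fin 4 → ℝ} (hv : ∑ a, v a * v a = 1) :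
    (quatMatrix v).conjTranspose * quatMatrix v = 1 :=
  mul_eq_one_comm.mp (quatMatrix_mul_conj_self hv)

/-- A unitary is a unit quaternion up to a phase. -/
theorem exists_phase_quatMatrix (U : Matrix.unitaryGroup (Fin 2) ℂ) :
    ∃ (z : ℂ) (v : Fin 4 → ℝ), z * star z = 1 ∧ ∑ a, v a * v a = 1 ∧
      (U : Matrix (Fin 2) (Fin 2) ℂ) = z • quatMatrix v := by
  obtain ⟨U, hU⟩ := U
  -- Dividing by a square root `z` of the determinant moves `U` into `SU(2)`, where the adjugate
  -- equals the adjoint; comparing entries gives the quaternion form.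
  obtain ⟨z, hz⟩ := IsAlgClosed.exists_eq_mul_self U.det
  have hU1 := Matrix.mem_unitaryGroup_iff.mp hU
  have hdet : U.det * star U.det = 1 := by
    have := congrArg Matrix.det hU1
    rwa [Matrix.det_mul, Matrix.star_eq_conjTranspose, Matrix.det_conjTranspose,
      Matrix.det_one] at this
  have hzz : z * star z = 1 := by
    rw [← starRingEnd_apply, Complex.mul_conj'] at hdet ⊢
    have h1 : ‖U.det‖ ^ 2 = 1 := by exact_mod_cast hdet
    rw [hz, norm_mul, ← sq, ← pow_mul] at h1
    have h2 : ‖z‖ = 1 := (pow_eq_one_iff_of_nonneg (norm_nonneg z) (by norm_num)).mp h1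
    rw [h2]; norm_num
  set V := star z • U with hV
  have hUV : U = z • V := by rw [hV, smul_smul, hzz, one_smul]
  have hVV : V * star V = 1 := by
    rw [hV, star_smul, star_star, Matrix.smul_mul, Matrix.mul_smul, smul_smul, hU1, mul_comm, hzz,
      one_smul]
  have hVd : V.det = 1 := by
    rw [hV, Matrix.det_smul, hz, Fintype.card_fin]
    linear_combination (z * star z + 1) * hzz
  have hadj : V.adjugate = star V := by
    have h := Matrix.adjugate_mul V
    rw [hVd, one_smul] at h
    calc V.adjugate = V.adjugate * (V * star V) := by rw [hVV, mul_one]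
      _ = star V := by rw [← mul_assoc, h, one_mul]
  rw [Matrix.adjugate_fin_two] at hadj
  have h0 : V 1 1 = star (V 0 0) := by
    have := congrFun (congrFun hadj 0) 0
    simpa [Matrix.star_apply] using this
  have h1 : V 1 0 = -star (V 0 1) := by
    have := congrFun (congrFun hadj 1) 0
    simp only [Matrix.star_apply] at this
    rw [← this]
    simp
  refine ⟨z, ![(V 0 0).re, (V 0 1).im, (V 0 1).re, (V 0 0).im], hzz, ?_, ?_⟩
  · rw [Matrix.det_fin_two, h0, h1] at hVd
    have := congrArg Complex.re hVd
    simp at this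
    simp [Fin.sum_univ_four]
    linarith
  · refine hUV.trans ?_
    congr 1
    ext x y
    fin_cases x <;> fin_cases y <;> apply Complex.ext <;> simp [quatMatrix, h0, h1]

/-- The hypotheses make `A B†` anti-Hermitian and unitary, hence of square `-1`; the factor `i`
corrects both signs. -/
theorem isSpin_of_anticommute {A B : Matrix (Fin 2) (Fin 2) ℂ} (hA : A * A.conjTranspose = 1)
    (hB : B.conjTranspose * B = 1)
    (h : A * B.conjTranspose + B * A.conjTranspose = 0) (htr : (A * B.conjTranspose).trace = 0) :
    IsSpin (Complex.I • (A * B.conjTranspose)) := by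
  have h' : B * A.conjTranspose = -(A * B.conjTranspose) := (neg_eq_of_add_eq_zero_right h).symm
  refine ⟨?_, ?_, ?_⟩
  · rw [Matrix.IsHermitian, Matrix.conjTranspose_smul, Matrix.conjTranspose_mul,
      Matrix.conjTranspose_conjTranspose, h']
    simp
  · rw [Matrix.smul_mul, Matrix.mul_smul, smul_smul, Complex.I_mul_I, neg_one_smul, ← mul_neg, ← h',
      mul_assoc, ← mul_assoc B.conjTranspose, hB, one_mul, hA]
  · rw [Matrix.trace_smul, htr, smul_zero]

section QuaternionFrame

variable {e : Fin 4 → Fin 4 → ℝ}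

theorem quatMatrix_frame_mul_conj (he : ∀ j l, ∑ a, e j a * e l a = if j = l then 1 else 0)
    {j l : Fin 4} (h : j ≠ l) :
    quatMatrix (e j) * (quatMatrix (e l)).conjTranspose +
      quatMatrix (e l) * (quatMatrix (e j)).conjTranspose = 0 := by
  rw [quatMatrix_mul_conj_add, he, if_neg h]
  simp

theorem quatMatrix_frame_conj_mul (he : ∀ j l, ∑ a, e j a * e l a = if j = l then 1 else 0)
    {j l : Fin 4} (h : j ≠ l) :
    (quatMatrix (e j)).conjTranspose * quatMatrix (e l) +
      (quatMatrix (e l)).conjTranspose * quatMatrix (e j) = 0 := by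
  rw [quatMatrix_conj_mul_add, he, if_neg h]
  simp

/-- The signs are those of Pauli conjugation, but the input observable `i E₀† E_s` and the output
observable `i E_s E₀†` differ: the frame realizes the Pauli matrices between two bases. In the
generic case three anticommutations leave the sign `-1`. -/
theorem quatMatrix_frame_sandwich (he : ∀ j l, ∑ a, e j a * e l a = if j = l then 1 else 0)
    (l s : Fin 4) (hs : s ≠ 0) :
    quatMatrix (e l) * (Complex.I • ((quatMatrix (e 0)).conjTranspose * quatMatrix (e s))) *
      (quatMatrix (e l)).conjTranspose =
    (pauliSign l s : ℂ) • (Complex.I • (quatMatrix (e s) * (quatMatrix (e 0)).conjTranspose)) := by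
  have hself : ∀ j, ∑ a, e j a * e j a = 1 := fun j => by rw [he, if_pos rfl]
  have h1 : ∀ j, quatMatrix (e j) * (quatMatrix (e j)).conjTranspose = 1 := fun j =>
    quatMatrix_mul_conj_self (hself j)
  rw [Matrix.mul_smul, Matrix.smul_mul, smul_comm]
  congr 1
  by_cases hl0 : l = 0
  · subst hl0
    simp [pauliSign, ← mul_assoc, h1]
  by_cases hls : l = s
  · subst hls
    simp [pauliSign, mul_assoc, h1]
  · have ha := eq_neg_of_add_eq_zero_left (quatMatrix_frame_mul_conj he hl0)
    have hb := eq_neg_of_add_eq_zero_left (quatMatrix_frame_conj_mul he hls)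
    have hc := eq_neg_of_add_eq_zero_left (quatMatrix_frame_mul_conj he hs)
    rw [hc, ← mul_assoc, ha, neg_mul, mul_assoc (quatMatrix (e 0)), hb]
    simp [pauliSign, hs, hl0, hls, mul_assoc, h1]

end QuaternionFrame

/-! ### Reduction of a single-qubit scheme to a Pauli scheme -/

/-- Entropy does not increase from a mixture of rank-one projections to its spectrum. -/
theorem sum_negMulLog_le {κ ι : Type*} [Fintype κ] [Fintype ι] [DecidableEq ι] {w : κ → ℝ}
    (hw : ∀ k, 0 ≤ w k) {a : κ → ι → ℝ} (ha : ∀ k, ∑ j, a k j ^ 2 = 1) {q : ι → ℝ}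
    (hq : ∀ j l, ∑ k, w k * a k j * a k l = if j = l then q j else 0) :
    ∑ j, Real.negMulLog (q j) ≤ ∑ k, Real.negMulLog (w k) := by
  have hqs : ∀ j, q j = ∑ k, w k * a k j ^ 2 := by
    intro j
    have := hq j j
    rw [if_pos rfl] at this
    rw [← this]
    exact Finset.sum_congr rfl fun k _ => by ring
  have hq0 : ∀ j, 0 ≤ q j := fun j => by
    rw [hqs]; exact Finset.sum_nonneg fun k _ => mul_nonneg (hw k) (sq_nonneg _)
  have hzero : ∀ j, q j = 0 → ∀ k, w k * a k j ^ 2 = 0 := by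
    intro j hj k
    rw [hqs] at hj
    exact (Finset.sum_eq_zero_iff_of_nonneg fun k _ => mul_nonneg (hw k) (sq_nonneg _)).mp hj k
      (Finset.mem_univ k)
  have hquad : ∀ x : ι → ℝ, ∑ k, w k * (∑ j, a k j * x j) ^ 2 = ∑ j, q j * x j ^ 2 := by
    intro x
    have h1 : ∀ k, w k * (∑ j, a k j * x j) ^ 2 =
        ∑ j, ∑ l, (w k * a k j * a k l) * (x j * x l) := by
      intro k
      rw [sq, Finset.sum_mul_sum, Finset.mul_sum]
      refine Finset.sum_congr rfl fun j _ => ?_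
      rw [Finset.mul_sum]
      exact Finset.sum_congr rfl fun l _ => by ring
    simp_rw [h1]
    rw [Finset.sum_comm]
    refine Finset.sum_congr rfl fun j _ => ?_
    rw [Finset.sum_comm]
    simp_rw [← Finset.sum_mul, hq]
    simp only [ite_mul, zero_mul, Finset.sum_ite_eq, Finset.mem_univ, if_true, sq]
  -- The matrix `B` carries `q` to `w`. Its columns with `q j ≠ 0` sum to `1` and its rows to at
  -- most `1`. Where `q j = 0` division gives `0`, consistently with `w k * a k j ^ 2 = 0`.
  set B : κ → ι → ℝ := fun k j => w k * a k j ^ 2 / q j with hB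
  have hB0 : ∀ k j, 0 ≤ B k j := fun k j =>
    div_nonneg (mul_nonneg (hw k) (sq_nonneg _)) (hq0 j)
  have hBq : ∀ k j, B k j * q j = w k * a k j ^ 2 := by
    intro k j
    by_cases hj : q j = 0
    · rw [hj, mul_zero, hzero j hj k]
    · exact div_mul_cancel₀ _ hj
  have hcol : ∀ j, q j ≠ 0 → ∑ k, B k j = 1 := by
    intro j hj
    rw [hB, ← Finset.sum_div, ← hqs, div_self hj]
  have hrow : ∀ k, ∑ j, B k j ≤ 1 := by
    intro k
    -- The single term `k` of the quadratic form is at most the whole form. At the point `a k j / q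
    -- j` this reads `w k * s ^ 2 ≤ s`, hence `w k * s ≤ 1`.
    have h1 := hquad fun j => a k j / q j
    set s := ∑ j, a k j * (a k j / q j) with hs
    have h2 : ∑ j, q j * (a k j / q j) ^ 2 = s := by
      refine Finset.sum_congr rfl fun j _ => ?_
      by_cases hj : q j = 0
      · simp [hj]
      · field_simp
    have h3 : w k * s ^ 2 ≤ s := by
      rw [h2] at h1
      conv_rhs => rw [← h1]
      exact Finset.single_le_sum (f := fun k' => w k' * (∑ j, a k' j * (a k j / q j)) ^ 2)
        (fun k' _ => mul_nonneg (hw k') (sq_nonneg _)) (Finset.mem_univ k)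
    have h4 : ∑ j, B k j = w k * s := by
      rw [hs, Finset.mul_sum]
      exact Finset.sum_congr rfl fun j _ => by rw [hB]; ring
    have h5 : 0 ≤ s := by
      rw [hs]
      exact Finset.sum_nonneg fun j _ => by
        rw [← mul_div_assoc]
        exact div_nonneg (mul_self_nonneg _) (hq0 j)
    rw [h4]
    by_contra! h6
    rcases h5.eq_or_lt with h7 | h7
    · rw [← h7] at h6; norm_num at h6
    · nlinarith
  have hmain : ∀ k, ∑ j, B k j * Real.negMulLog (q j) ≤ Real.negMulLog (w k) := by
    intro k
    -- The missing row mass is placed at the extra point `none` with value `0`; it changes neither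
    -- the mean nor the sum, as `negMulLog 0 = 0`.
    have hj := Real.concaveOn_negMulLog.le_map_sum (t := (Finset.univ : Finset (Option ι)))
      (w := fun o => o.elim (1 - ∑ j, B k j) (B k)) (p := fun o => o.elim 0 q)
      (by
        rintro (_ | j) -
        · simpa using hrow k
        · exact hB0 k j)
      (by rw [Fintype.sum_option]; simp)
      (by
        rintro (_ | j) -
        · simp
        · exact hq0 j)
    rw [Fintype.sum_option, Fintype.sum_option] at hj
    have hwk : ∑ j, B k j * q j = w k := by
      simp_rw [hBq, ← Finset.mul_sum, ha, mul_one]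
    simpa [hwk] using hj
  calc ∑ j, Real.negMulLog (q j) = ∑ j, (∑ k, B k j) * Real.negMulLog (q j) := by
        refine Finset.sum_congr rfl fun j _ => ?_
        by_cases hj : q j = 0
        · simp [hj]
        · rw [hcol j hj, one_mul]
    _ = ∑ k, ∑ j, B k j * Real.negMulLog (q j) := by
        simp_rw [Finset.sum_mul]
        rw [Finset.sum_comm]
    _ ≤ _ := Finset.sum_le_sum fun k _ => hmain k

theorem EncryptionScheme.entropy_eq {d : Type} [Fintype d] [DecidableEq d]
    (S : EncryptionScheme d) :
    S.entropy = (∑ k, Real.negMulLog (S.weight k)) / Real.log 2 := by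
  simp only [entropy, Real.negMulLog, Real.logb, Finset.sum_div, ← Finset.sum_neg_distrib]
  exact Finset.sum_congr rfl fun k _ => by ring

/-- A finite family of vectors can be written in an orthonormal frame that diagonalizes its
weighted Gram matrix. -/
theorem exists_diagonalizing_frame {κ : Type*} [Fintype κ] (w : κ → ℝ) (v : κ → Fin 4 → ℝ) :
    ∃ (e : Fin 4 → Fin 4 → ℝ) (a : κ → Fin 4 → ℝ) (q : Fin 4 → ℝ),
      (∀ j l, ∑ b, e j b * e l b = if j = l then 1 else 0) ∧
      (∀ k, v k = fun b => ∑ j, a k j * e j b) ∧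
      (∀ k, ∑ j, a k j ^ 2 = ∑ b, v k b * v k b) ∧
      (∀ j l, ∑ k, w k * a k j * a k l = if j = l then q j else 0) := by
  classical
  set V : Matrix κ (Fin 4) ℝ := Matrix.of v with hV
  set C : Matrix (Fin 4) (Fin 4) ℝ := V.transpose * Matrix.diagonal w * V with hC
  have hCh : C.IsHermitian := by
    rw [Matrix.IsHermitian, Matrix.conjTranspose_eq_transpose_of_trivial, hC]
    simp [Matrix.transpose_mul, Matrix.mul_assoc]
  set O : Matrix (Fin 4) (Fin 4) ℝ := hCh.eigenvectorUnitary.1 with hO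
  have hOO : O * O.transpose = 1 := by
    have := Matrix.mem_unitaryGroup_iff.mp hCh.eigenvectorUnitary.2
    rwa [Matrix.star_eq_conjTranspose, Matrix.conjTranspose_eq_transpose_of_trivial] at this
  have hOO' : O.transpose * O = 1 := mul_eq_one_comm.mp hOO
  have hdiag : O.transpose * C * O = Matrix.diagonal hCh.eigenvalues := by
    have := hCh.conjStarAlgAut_star_eigenvectorUnitary
    rw [Unitary.conjStarAlgAut_apply] at this
    simpa [Matrix.star_eq_conjTranspose, Matrix.conjTranspose_eq_transpose_of_trivial] using this
  set a : Matrix κ (Fin 4) ℝ := V * O with ha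
  refine ⟨O.transpose, a, hCh.eigenvalues, ?_, ?_, ?_, ?_⟩
  · intro j l
    have := congrFun (congrFun hOO' j) l
    rw [Matrix.mul_apply, Matrix.one_apply] at this
    simpa using this
  · intro k
    have : V = a * O.transpose := by rw [ha, Matrix.mul_assoc, hOO, Matrix.mul_one]
    ext b
    have := congrFun (congrFun this k) b
    rwa [Matrix.mul_apply] at this
  · intro k
    have : a * a.transpose = V * V.transpose := by
      rw [ha, Matrix.transpose_mul, Matrix.mul_assoc, ← Matrix.mul_assoc O, hOO, Matrix.one_mul]
    have := congrFun (congrFun this k) k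
    rw [Matrix.mul_apply, Matrix.mul_apply] at this
    simp only [Matrix.transpose_apply, ← sq] at this
    rw [this]
    exact Finset.sum_congr rfl fun b _ => sq _
  · intro j l
    have : a.transpose * Matrix.diagonal w * a = Matrix.diagonal hCh.eigenvalues := by
      rw [← hdiag, hC, ha, Matrix.transpose_mul]
      simp only [Matrix.mul_assoc]
    have := congrFun (congrFun this j) l
    rw [Matrix.mul_apply, Matrix.diagonal_apply] at this
    rw [← this]
    refine Finset.sum_congr rfl fun k _ => ?_
    rw [Matrix.mul_diagonal, Matrix.transpose_apply, mul_comm (w k)]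

/-- Every single-qubit scheme is, up to a choice of bases, a Pauli scheme of at most the same
entropy. -/
theorem EncryptionScheme.exists_pauli (S : EncryptionScheme (Fin 2)) :
    ∃ q : stdSimplex ℝ (Fin 4), (pauliScheme q).entropy ≤ S.entropy ∧
      ∀ s, s ≠ 0 → S.Attains |pauliFactor q.1 s| := by
  choose z v hz hv hU using fun k => exists_phase_quatMatrix (S.unitary k)
  obtain ⟨e, a, q, he, hva, han, hq⟩ := exists_diagonalizing_frame S.weight v
  simp_rw [hv] at han
  have hqs : ∀ j, q j = ∑ k, S.weight k * a k j ^ 2 := by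
    intro j
    have := hq j j
    rw [if_pos rfl] at this
    rw [← this]
    exact Finset.sum_congr rfl fun k _ => by ring
  have hq0 : ∀ j, 0 ≤ q j := fun j => by
    rw [hqs]; exact Finset.sum_nonneg fun k _ => mul_nonneg (S.weight_nonneg k) (sq_nonneg _)
  have hq1 : ∑ j, q j = 1 := by
    simp_rw [hqs]
    rw [Finset.sum_comm]
    simp_rw [← Finset.mul_sum, han, mul_one, S.weight_sum]
  -- Expanded in the frame, conjugation produces cross terms `j ≠ l`, and the diagonalized Gram
  -- matrix cancels them after averaging over the keys.
  have henc : ∀ A, S.encrypt A =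
      ∑ j, (q j : ℂ) • (quatMatrix (e j) * A * (quatMatrix (e j)).conjTranspose) := by
    intro A
    have h1 : ∀ k, (S.weight k : ℂ) • ((S.unitary k : Matrix (Fin 2) (Fin 2) ℂ) * A *
        (S.unitary k : Matrix (Fin 2) (Fin 2) ℂ).conjTranspose) =
        ∑ j, ∑ l, ((S.weight k * a k j * a k l : ℝ) : ℂ) •
          (quatMatrix (e j) * A * (quatMatrix (e l)).conjTranspose) := by
      intro k
      have h2 : (S.unitary k : Matrix (Fin 2) (Fin 2) ℂ) * A *
          (S.unitary k : Matrix (Fin 2) (Fin 2) ℂ).conjTranspose =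
          quatMatrix (v k) * A * (quatMatrix (v k)).conjTranspose := by
        rw [hU, Matrix.conjTranspose_smul, Matrix.smul_mul, Matrix.smul_mul, Matrix.mul_smul,
          smul_smul, hz, one_smul]
      rw [h2, hva k, quatMatrix_sum, Matrix.conjTranspose_sum, Finset.sum_mul, Finset.sum_mul_sum,
        Finset.smul_sum]
      refine Finset.sum_congr rfl fun j _ => ?_
      rw [Finset.smul_sum]
      refine Finset.sum_congr rfl fun l _ => ?_
      simp only [Matrix.conjTranspose_smul, Matrix.smul_mul, Matrix.mul_smul, smul_smul]
      congr 1
      simp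
      ring
    rw [EncryptionScheme.encrypt]
    simp_rw [h1]
    rw [Finset.sum_comm]
    refine Finset.sum_congr rfl fun j _ => ?_
    rw [Finset.sum_comm]
    simp_rw [← Finset.sum_smul, ← Complex.ofReal_sum, hq]
    rw [Finset.sum_eq_single j]
    · simp
    · intro l _ hl
      simp [hl.symm]
    · simp
  refine ⟨⟨q, hq0, hq1⟩, ?_, ?_⟩
  · rw [EncryptionScheme.entropy_eq, EncryptionScheme.entropy_eq]
    exact div_le_div_of_nonneg_right (sum_negMulLog_le S.weight_nonneg han hq)
      (Real.log_nonneg (by norm_num))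
  · intro s hs
    have hself : ∀ j, ∑ b, e j b * e j b = 1 := fun j => by rw [he, if_pos rfl]
    have hin : IsSpin (Complex.I • ((quatMatrix (e 0)).conjTranspose * quatMatrix (e s))) := by
      have := isSpin_of_anticommute (A := (quatMatrix (e 0)).conjTranspose)
        (B := (quatMatrix (e s)).conjTranspose)
      simp only [Matrix.conjTranspose_conjTranspose] at this
      refine this (quatMatrix_conj_mul_self (hself 0)) (quatMatrix_mul_conj_self (hself s))
        (quatMatrix_frame_conj_mul he hs.symm) ?_
      rw [Matrix.trace_mul_comm, quatMatrix_trace_mul_conj, he, if_neg hs]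
      simp
    have hout : IsSpin (Complex.I • (quatMatrix (e s) * (quatMatrix (e 0)).conjTranspose)) := by
      refine isSpin_of_anticommute (quatMatrix_mul_conj_self (hself s))
        (quatMatrix_conj_mul_self (hself 0)) (quatMatrix_frame_mul_conj he hs) ?_
      rw [quatMatrix_trace_mul_conj, he, if_neg hs]
      simp
    refine ⟨_, hin.isState, _, hout, pauliFactor q s, rfl, ?_⟩
    have h1 : S.encrypt 1 = 1 := by
      rw [henc]
      simp_rw [mul_one, fun j => quatMatrix_mul_conj_self (hself j), ← Finset.sum_smul,
        ← Complex.ofReal_sum, hq1]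
      simp
    have h2 : S.encrypt (Complex.I • ((quatMatrix (e 0)).conjTranspose * quatMatrix (e s))) =
        (pauliFactor q s : ℂ) •
          (Complex.I • (quatMatrix (e s) * (quatMatrix (e 0)).conjTranspose)) := by
      rw [henc]
      simp_rw [fun l => quatMatrix_frame_sandwich he l s hs, smul_smul (q _ : ℂ),
        ← Finset.sum_smul, pauliFactor]
      push_cast
      rfl
    rw [blochMatrix, blochMatrix, EncryptionScheme.encrypt_smul, EncryptionScheme.encrypt_add, h1,
      Complex.ofReal_one, one_smul, h2]

/-! ### The exact error of a Pauli scheme -/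

/-- The largest factor by which the Pauli scheme with weights `p` scales a Bloch vector. -/
noncomputable def pauliNorm (p : Fin 4 → ℝ) : ℝ :=
  max |pauliFactor p 1| (max |pauliFactor p 2| |pauliFactor p 3|)

theorem abs_pauliFactor_le (p : Fin 4 → ℝ) {s : Fin 4} (hs : s ≠ 0) :
    |pauliFactor p s| ≤ pauliNorm p := by
  fin_cases s
  · exact absurd rfl hs
  · exact le_max_left _ _
  · exact (le_max_left _ _).trans (le_max_right _ _)
  · exact (le_max_right _ _).trans (le_max_right _ _)

theorem exists_pauliNorm_eq (p : Fin 4 → ℝ) : ∃ s, s ≠ 0 ∧ pauliNorm p = |pauliFactor p s| := by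
  unfold pauliNorm
  rcases max_choice |pauliFactor p 1| (max |pauliFactor p 2| |pauliFactor p 3|) with h | h
  · exact ⟨1, by decide, h⟩
  · rcases max_choice |pauliFactor p 2| |pauliFactor p 3| with h' | h'
    · exact ⟨2, by decide, h.trans h'⟩
    · exact ⟨3, by decide, h.trans h'⟩

theorem pauliNorm_nonneg (p : Fin 4 → ℝ) : 0 ≤ pauliNorm p :=
  (abs_nonneg _).trans (le_max_left _ _)

theorem continuous_pauliNorm : Continuous pauliNorm := by
  unfold pauliNorm pauliFactor
  fun_prop

theorem abs_pauliFactor_le_one (p : stdSimplex ℝ (Fin 4)) (s : Fin 4) :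
    |pauliFactor p.1 s| ≤ 1 := by
  refine (Finset.abs_sum_le_sum_abs _ _).trans ?_
  rw [← p.2.2]
  refine Finset.sum_le_sum fun k _ => le_of_eq ?_
  rw [abs_mul, abs_of_nonneg (p.2.1 k), pauliSign]
  split_ifs <;> simp

theorem pauliNorm_le_one (p : stdSimplex ℝ (Fin 4)) : pauliNorm p.1 ≤ 1 := by
  obtain ⟨s, -, h⟩ := exists_pauliNorm_eq p.1
  exact h ▸ abs_pauliFactor_le_one p s

theorem pauliScheme_encrypt_one (p : stdSimplex ℝ (Fin 4)) : (pauliScheme p).encrypt 1 = 1 := by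
  have := pauliScheme_encrypt_pauli p 0
  rwa [pauli_zero, pauliFactor_zero, Complex.ofReal_one, one_smul] at this

theorem pauliScheme_attains (p : stdSimplex ℝ (Fin 4)) {s : Fin 4} (hs : s ≠ 0) :
    (pauliScheme p).Attains |pauliFactor p.1 s| := by
  refine ⟨_, (pauli_isSpin hs).isState, _, pauli_isSpin hs, _, rfl, ?_⟩
  rw [blochMatrix, blochMatrix, EncryptionScheme.encrypt_smul, EncryptionScheme.encrypt_add,
    pauliScheme_encrypt_one, Complex.ofReal_one, one_smul, pauliScheme_encrypt_pauli]

theorem pauliScheme_attains_norm (p : stdSimplex ℝ (Fin 4)) :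
    (pauliScheme p).Attains (pauliNorm p.1) := by
  obtain ⟨s, hs, h⟩ := exists_pauliNorm_eq p.1
  exact h ▸ pauliScheme_attains p hs

/-- Both singular values equal `c`, so after normalization the two norms agree; this is the source
of the norm-independence for one qubit. -/
theorem schattenNorm_of_mul_self {A : Matrix (Fin 2) (Fin 2) ℂ} (hA : A.IsHermitian) {c : ℝ}
    (hc : 0 ≤ c) (h : A * A = ((c ^ 2 : ℝ) : ℂ) • 1) (ν : NormIndex) :
    schattenNorm ν A = 2 * c / ν.scale (Fintype.card (Fin 2)) := by
  cases ν
  · have h1 := sum_norm_sq_eq_trace A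
    rw [hA.eq, h, Matrix.trace_smul, Matrix.trace_one, Fintype.card_fin] at h1
    have h2 : ∑ x, ∑ y, ‖A x y‖ ^ 2 = c ^ 2 * 2 := by
      rw [← Complex.ofReal_inj, h1]
      simp
    rw [← schattenNorm_two_sq] at h2
    refine (sq_eq_sq₀ (schattenNorm_nonneg _ _) ?_).mp ?_
    · exact div_nonneg (by positivity) (Real.sqrt_nonneg _)
    · rw [h2, NormIndex.scale, div_pow, Real.sq_sqrt (by positivity), Fintype.card_fin]
      push_cast
      ring
  · have h1 := Matrix.l2_opNorm_conjTranspose_mul_self A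
    rw [hA.eq, h] at h1
    have h2 : schattenNorm .infty A * schattenNorm .infty A = c ^ 2 := by
      refine h1.symm.trans ?_
      open scoped Matrix.Norms.L2Operator in
      rw [norm_smul, norm_one, mul_one, Complex.norm_real, Real.norm_of_nonneg (sq_nonneg c)]
    rw [← sq] at h2
    rw [(sq_eq_sq₀ (schattenNorm_nonneg _ _) hc).mp h2, NormIndex.scale, Fintype.card_fin]
    push_cast
    ring

/-- The bound on the Bloch vector is nonnegativity of the determinant, which is `(1 - x² - y² - z²)
/ 4`. -/
theorem IsState.exists_bloch {ρ : Matrix (Fin 2) (Fin 2) ℂ} (hρ : IsState ρ) :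
    ∃ x y z : ℝ, x ^ 2 + y ^ 2 + z ^ 2 ≤ 1 ∧
      ρ = (2⁻¹ : ℂ) • (pauli 0 + (x : ℂ) • pauli 1 + (y : ℂ) • pauli 2 + (z : ℂ) • pauli 3) := by
  have htr := hρ.2
  rw [Matrix.trace_fin_two] at htr
  have h10 : ρ 1 0 = star (ρ 0 1) := (hρ.1.1.apply 1 0).symm
  have h00 : (ρ 0 0).im = 0 := by
    have := congrArg Complex.im (hρ.1.1.apply 0 0)
    simp at this
    linarith
  have h11 : ρ 1 1 = 1 - ρ 0 0 := by rw [← htr]; ring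
  have hdet := (Complex.nonneg_iff.mp hρ.1.det_nonneg).1
  rw [Matrix.det_fin_two, h10, h11] at hdet
  simp [h00] at hdet
  refine ⟨2 * (ρ 0 1).re, -2 * (ρ 0 1).im, 2 * (ρ 0 0).re - 1, by nlinarith, ?_⟩
  ext i j
  fin_cases i <;> fin_cases j <;> apply Complex.ext <;> simp [pauli, h10, h11, h00]
  ring

theorem pauliScheme_errorLe (p : stdSimplex ℝ (Fin 4)) (ν : NormIndex) :
    (pauliScheme p).ErrorLe ν (pauliNorm p.1) := by
  intro ρ hρ
  obtain ⟨x, y, z, hxyz, rfl⟩ := hρ.exists_bloch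
  set a := pauliFactor p.1 1 * x with ha
  set b := pauliFactor p.1 2 * y with hb
  set c := pauliFactor p.1 3 * z with hc
  have hout : (pauliScheme p).encrypt ((2⁻¹ : ℂ) • (pauli 0 + (x : ℂ) • pauli 1 +
      (y : ℂ) • pauli 2 + (z : ℂ) • pauli 3)) - ((Fintype.card (Fin 2) : ℂ)⁻¹) • 1 =
      (2⁻¹ : ℂ) • ((a : ℂ) • pauli 1 + (b : ℂ) • pauli 2 + (c : ℂ) • pauli 3) := by
    simp only [EncryptionScheme.encrypt_smul, EncryptionScheme.encrypt_add,
      pauliScheme_encrypt_pauli, pauli_zero, pauliScheme_encrypt_one, Fintype.card_fin, ha, hb, hc]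
    push_cast
    module
  have hherm : ((2⁻¹ : ℂ) • ((a : ℂ) • pauli 1 + (b : ℂ) • pauli 2 +
      (c : ℂ) • pauli 3)).IsHermitian := by
    simp [Matrix.IsHermitian, Matrix.conjTranspose_smul, (pauli_isHermitian _).eq]
  have hsq : ((2⁻¹ : ℂ) • ((a : ℂ) • pauli 1 + (b : ℂ) • pauli 2 + (c : ℂ) • pauli 3)) *
      ((2⁻¹ : ℂ) • ((a : ℂ) • pauli 1 + (b : ℂ) • pauli 2 + (c : ℂ) • pauli 3)) =
      (((√(a ^ 2 + b ^ 2 + c ^ 2) / 2) ^ 2 : ℝ) : ℂ) • 1 := by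
    have hr : 4 * (√(a ^ 2 + b ^ 2 + c ^ 2) / 2) ^ 2 = a ^ 2 + b ^ 2 + c ^ 2 := by
      rw [div_pow, Real.sq_sqrt (by positivity)]
      ring
    generalize (√(a ^ 2 + b ^ 2 + c ^ 2) / 2) ^ 2 = r at hr
    ext i j
    fin_cases i <;> fin_cases j <;> apply Complex.ext <;>
      simp [pauli, Matrix.mul_apply, Fin.sum_univ_two] <;> linarith
  rw [EncryptionScheme.distMixed, hout, schattenNorm_of_mul_self hherm (by positivity) hsq]
  have hscale : 0 ≤ ν.scale (Fintype.card (Fin 2)) := by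
    cases ν
    · exact Real.sqrt_nonneg _
    · exact Nat.cast_nonneg _
  refine div_le_div_of_nonneg_right ?_ hscale
  rw [mul_div_cancel₀ _ two_ne_zero]
  refine Real.sqrt_le_iff.mpr ⟨pauliNorm_nonneg _, ?_⟩
  have hf : ∀ s, s ≠ 0 → pauliFactor p.1 s ^ 2 ≤ pauliNorm p.1 ^ 2 := fun s hs => by
    rw [← sq_abs]
    exact pow_le_pow_left₀ (abs_nonneg _) (abs_pauliFactor_le _ hs) 2
  have h1 := mul_le_mul_of_nonneg_right (hf 1 (by decide)) (sq_nonneg x)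
  have h2 := mul_le_mul_of_nonneg_right (hf 2 (by decide)) (sq_nonneg y)
  have h3 := mul_le_mul_of_nonneg_right (hf 3 (by decide)) (sq_nonneg z)
  have h4 := mul_le_mul_of_nonneg_left hxyz (sq_nonneg (pauliNorm p.1))
  simp only [ha, hb, hc, mul_pow]
  linarith

/-! ### Entropy of Pauli schemes and existence of an optimal one -/

theorem pauliScheme_entropy (p : stdSimplex ℝ (Fin 4)) :
    (pauliScheme p).entropy = (∑ k, Real.negMulLog (p.1 k)) / Real.log 2 :=
  EncryptionScheme.entropy_eq _

theorem log_four : Real.log 4 = 2 * Real.log 2 := by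
  rw [show (4 : ℝ) = 2 ^ 2 by norm_num, Real.log_pow]
  norm_num

theorem pauliScheme_entropy_le_two (p : stdSimplex ℝ (Fin 4)) : (pauliScheme p).entropy ≤ 2 := by
  rw [pauliScheme_entropy, div_le_iff₀ (Real.log_pos (by norm_num)), ← log_four]
  have h : ∀ k, Real.negMulLog (p.1 k) ≤ p.1 k * Real.log 4 + (1 / 4 - p.1 k) := by
    intro k
    rcases (p.2.1 k).eq_or_lt with h0 | h0
    · rw [← h0]; norm_num
    · have h1 := Real.log_le_sub_one_of_pos (x := (4 * p.1 k)⁻¹) (by positivity)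
      rw [Real.log_inv, Real.log_mul (by norm_num) h0.ne'] at h1
      have h2 := mul_le_mul_of_nonneg_left h1 h0.le
      have h3 : p.1 k * ((4 * p.1 k)⁻¹ - 1) = 1 / 4 - p.1 k := by field_simp
      rw [h3] at h2
      rw [Real.negMulLog]
      linarith
  refine (Finset.sum_le_sum fun k _ => h k).trans (le_of_eq ?_)
  rw [Finset.sum_add_distrib, ← Finset.sum_mul, Finset.sum_sub_distrib, p.2.2]
  norm_num

/-- The inequality `log (4p) ≤ 4p - 1` bounds the deficit by `4 ∑ p² - 1`, which by Parseval is the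
sum of the three squared factors. -/
theorem two_sub_pauliScheme_entropy_le (p : stdSimplex ℝ (Fin 4)) :
    2 - (pauliScheme p).entropy ≤ 3 * pauliNorm p.1 ^ 2 / Real.log 2 := by
  have hl : 0 < Real.log 2 := Real.log_pos (by norm_num)
  rw [pauliScheme_entropy, sub_le_iff_le_add, ← add_div, le_div_iff₀ hl, ← log_four]
  have h : ∀ k, p.1 k * Real.log 4 ≤ p.1 k * (4 * p.1 k - 1) + Real.negMulLog (p.1 k) := by
    intro k
    rcases (p.2.1 k).eq_or_lt with h0 | h0
    · rw [← h0]; norm_num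
    · have h1 := Real.log_le_sub_one_of_pos (x := 4 * p.1 k) (by positivity)
      rw [Real.log_mul (by norm_num) h0.ne'] at h1
      have h2 := mul_le_mul_of_nonneg_left h1 h0.le
      rw [Real.negMulLog]
      linarith
  have h1 := Finset.sum_le_sum fun k (_ : k ∈ Finset.univ) => h k
  rw [← Finset.sum_mul, p.2.2, one_mul, Finset.sum_add_distrib] at h1
  refine h1.trans (add_le_add_left ?_ _)
  have hs : ∑ k, p.1 k * (4 * p.1 k - 1) =
      pauliFactor p.1 1 ^ 2 + pauliFactor p.1 2 ^ 2 + pauliFactor p.1 3 ^ 2 := by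
    have hp := p.2.2
    rw [Fin.sum_univ_four] at hp
    have h3 : p.1 3 = 1 - p.1 0 - p.1 1 - p.1 2 := by linarith
    simp only [pauliFactor, pauliSign, Fin.sum_univ_four]
    simp
    rw [h3]
    ring
  have hf : ∀ s, s ≠ 0 → pauliFactor p.1 s ^ 2 ≤ pauliNorm p.1 ^ 2 := fun s hs => by
    rw [← sq_abs]
    exact pow_le_pow_left₀ (abs_nonneg _) (abs_pauliFactor_le _ hs) 2
  rw [hs]
  linarith [hf 1 (by decide), hf 2 (by decide), hf 3 (by decide)]

/-- Mixing a Pauli scheme with the completely depolarizing one raises its entropy to any value up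
to `2` without increasing its error. -/
theorem exists_pauliScheme_entropy_eq (p : stdSimplex ℝ (Fin 4)) {H : ℝ}
    (h1 : (pauliScheme p).entropy ≤ H) (h2 : H ≤ 2) :
    ∃ q : stdSimplex ℝ (Fin 4), (pauliScheme q).entropy = H ∧ pauliNorm q.1 ≤ pauliNorm p.1 := by
  set F : ℝ → ℝ := fun t => (∑ k, Real.negMulLog ((1 - t) * p.1 k + t * 4⁻¹)) / Real.log 2 with hF
  have hcont : Continuous F := by
    rw [hF]
    fun_prop
  have h0 : F 0 = (pauliScheme p).entropy := by
    rw [pauliScheme_entropy]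
    simp [hF]
  have hF1 : F 1 = 2 := by
    have hl : Real.log 2 ≠ 0 := (Real.log_pos (by norm_num)).ne'
    simp only [hF, sub_self, zero_mul, zero_add, one_mul, Real.negMulLog, Real.log_inv, log_four,
      Finset.sum_const, Finset.card_univ, Fintype.card_fin, nsmul_eq_mul]
    field_simp
    norm_num
  -- Entropy varies continuously along the segment from `p` to the uniform distribution, while every
  -- nontrivial factor is multiplied by `1 - t`.
  obtain ⟨t, ht, hFt⟩ := intermediate_value_Icc (zero_le_one) hcont.continuousOn
    (show H ∈ Set.Icc (F 0) (F 1) from ⟨h0 ▸ h1, hF1 ▸ h2⟩)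
  refine ⟨⟨fun k => (1 - t) * p.1 k + t * 4⁻¹, fun k => ?_, ?_⟩, ?_, ?_⟩
  · exact add_nonneg (mul_nonneg (by linarith [ht.2]) (p.2.1 k))
      (mul_nonneg ht.1 (by norm_num))
  · rw [Finset.sum_add_distrib, ← Finset.mul_sum, p.2.2]
    simp
    ring
  · rw [pauliScheme_entropy]
    exact hFt
  · obtain ⟨s, hs, h⟩ := exists_pauliNorm_eq fun k => (1 - t) * p.1 k + t * 4⁻¹
    have hsum : ∑ k, pauliSign k s = 0 := by
      fin_cases s <;> simp [pauliSign, Fin.sum_univ_four] at hs ⊢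
    have hfac : pauliFactor (fun k => (1 - t) * p.1 k + t * 4⁻¹) s =
        (1 - t) * pauliFactor p.1 s := by
      simp only [pauliFactor, add_mul, Finset.sum_add_distrib, mul_assoc]
      simp only [← Finset.mul_sum, hsum]
      ring
    rw [h, hfac, abs_mul, abs_of_nonneg (by linarith [ht.2])]
    calc (1 - t) * |pauliFactor p.1 s| ≤ 1 * |pauliFactor p.1 s| :=
          mul_le_mul_of_nonneg_right (by linarith [ht.1]) (abs_nonneg _)
      _ ≤ pauliNorm p.1 := by rw [one_mul]; exact abs_pauliFactor_le _ hs

theorem exists_isOptimalPauli (ν : NormIndex) {H : ℝ} (h0 : 0 ≤ H) (h2 : H ≤ 2) :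
    ∃ (p : stdSimplex ℝ (Fin 4)) (ε : ℝ), IsOptimalPauli ν p ε H := by
  have hcont : Continuous fun p : stdSimplex ℝ (Fin 4) => (pauliScheme p).entropy := by
    simp_rw [pauliScheme_entropy]
    exact (continuous_finsetSum _ fun k _ => Real.continuous_negMulLog.comp
      ((continuous_apply k).comp continuous_subtype_val)).div_const _
  have hcpt : IsCompact {p : stdSimplex ℝ (Fin 4) | (pauliScheme p).entropy = H} :=
    (isClosed_eq hcont continuous_const).isCompact
  have hne : {p : stdSimplex ℝ (Fin 4) | (pauliScheme p).entropy = H}.Nonempty := by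
    have hv : (pauliScheme ⟨Pi.single 0 1, single_mem_stdSimplex ℝ 0⟩).entropy ≤ H := by
      rw [pauliScheme_entropy, Fin.sum_univ_four]
      simpa using h0
    obtain ⟨q, hq, -⟩ := exists_pauliScheme_entropy_eq _ hv h2
    exact ⟨q, hq⟩
  -- A minimizer of `pauliNorm` on the compact level set of the entropy is optimal, whatever `ν` is.
  obtain ⟨p, hp, hmin⟩ := hcpt.exists_isMinOn hne
    (continuous_pauliNorm.comp continuous_subtype_val).continuousOn
  refine ⟨p, pauliNorm p.1, ⟨hp, pauliScheme_errorLe p ν⟩, fun q ε' hq => ?_⟩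
  exact (hmin hq.1).trans ((pauliScheme_attains_norm q).le_of_errorLe hq.2)

namespace IsOptimalPauli

variable {ν : NormIndex} {p : stdSimplex ℝ (Fin 4)} {ε H : ℝ}

theorem eq_pauliNorm (h : IsOptimalPauli ν p ε H) : ε = pauliNorm p.1 :=
  le_antisymm (h.2 p _ ⟨h.1.1, pauliScheme_errorLe p ν⟩)
    ((pauliScheme_attains_norm p).le_of_errorLe h.1.2)

/-- Single-qubit schemes of at most the same entropy are no better than the optimal Pauli
scheme. -/
theorem exists_attains (h : IsOptimalPauli ν p ε H) {S : EncryptionScheme (Fin 2)}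
    (hS : S.entropy ≤ H) : ∃ m, ε ≤ m ∧ S.Attains m := by
  obtain ⟨q, hq, hatt⟩ := S.exists_pauli
  obtain ⟨r, hr, hrq⟩ := exists_pauliScheme_entropy_eq q (hq.trans hS)
    (h.1.1 ▸ pauliScheme_entropy_le_two p)
  obtain ⟨s, hs, hqs⟩ := exists_pauliNorm_eq q.1
  refine ⟨pauliNorm q.1, ?_, hqs ▸ hatt s hs⟩
  exact (h.2 r _ ⟨hr, pauliScheme_errorLe r ν⟩).trans hrq

end IsOptimalPauli

/-! ### Asymptotics of the exact errors -/

theorem one_add_pow_le_exp {a : ℝ} (ha : -1 ≤ a) (n : ℕ) : (1 + a) ^ n ≤ Real.exp (n * a) := by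
  rw [Real.exp_nat_mul]
  exact pow_le_pow_left₀ (by linarith) (by linarith [Real.add_one_le_exp a]) n

/-- The filter also admits negative `ε`, where the difference would be about `2 √n |ε|`; the value
`0` there makes the estimate true. With `x = √n ε`, Bernoulli and the exponential bound place the
radicand between `x²` and `x² + x⁴`. -/
theorem isLittleO_sqrt_one_add_sq_pow :
    (fun q : ℕ × ℝ => if 0 ≤ q.2 then √((1 + q.2 ^ 2) ^ q.1 - 1) - √(q.1 : ℝ) * q.2 else 0)
      =o[comap (fun q : ℕ × ℝ => √(q.1 : ℝ) * q.2) (𝓝 0)] fun q : ℕ × ℝ => √(q.1 : ℝ) * q.2 := by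
  rw [isLittleO_iff]
  intro c hc
  have hev : ∀ᶠ x : ℝ in 𝓝 0, |x| < min c 1 := by
    have := Metric.ball_mem_nhds (0 : ℝ) (lt_min hc one_pos)
    filter_upwards [this] with x hx
    simpa using hx
  filter_upwards [hev.comap _] with ⟨n, ε⟩ hx
  simp only at hx ⊢
  split_ifs with hε
  · set x := √(n : ℝ) * ε with hxdef
    have hx0 : 0 ≤ x := mul_nonneg (Real.sqrt_nonneg _) hε
    have hx2 : x ^ 2 = n * ε ^ 2 := by rw [hxdef, mul_pow, Real.sq_sqrt (Nat.cast_nonneg n)]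
    rw [abs_of_nonneg hx0] at hx
    have hxc := (hx.trans_le (min_le_left _ _)).le
    have hx1 := (hx.trans_le (min_le_right _ _)).le
    have hlow : x ^ 2 ≤ (1 + ε ^ 2) ^ n - 1 := by
      have := one_add_mul_le_pow (a := ε ^ 2) (by nlinarith [sq_nonneg ε]) n
      rw [hx2]
      linarith
    have hup : (1 + ε ^ 2) ^ n - 1 ≤ x ^ 2 + (x ^ 2) ^ 2 := by
      have h1 := one_add_pow_le_exp (a := ε ^ 2) (by nlinarith [sq_nonneg ε]) n
      rw [← hx2] at h1
      have h2 := (abs_le.mp (Real.abs_exp_sub_one_sub_id_le (x := x ^ 2)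
        (by rw [abs_of_nonneg (sq_nonneg x)]; exact pow_le_one₀ hx0 hx1))).2
      linarith
    rw [Real.norm_of_nonneg hx0, Real.norm_of_nonneg]
    · rw [sub_le_iff_le_add]
      refine Real.sqrt_le_iff.mpr ⟨by positivity, hup.trans ?_⟩
      have h3 : x ^ 2 ≤ c := by nlinarith
      nlinarith [mul_le_mul_of_nonneg_left h3 (sq_nonneg x), sq_nonneg (c * x)]
    · exact sub_nonneg.mpr (Real.le_sqrt_of_sq_le hlow)
  · rw [norm_zero]
    positivity

theorem isLittleO_one_add_pow :
    (fun q : ℕ × ℝ => (1 + q.2) ^ q.1 - 1 - (q.1 : ℝ) * q.2)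
      =o[comap (fun q : ℕ × ℝ => (q.1 : ℝ) * q.2) (𝓝 0)] fun q : ℕ × ℝ => (q.1 : ℝ) * q.2 := by
  rw [isLittleO_iff]
  intro c hc
  have hev : ∀ᶠ x : ℝ in 𝓝 0, |x| < min c 1 := by
    have := Metric.ball_mem_nhds (0 : ℝ) (lt_min hc one_pos)
    filter_upwards [this] with x hx
    simpa using hx
  filter_upwards [hev.comap _] with ⟨n, ε⟩ hx
  simp only at hx ⊢
  -- For `n = 0` the filter puts no restriction on `ε`, but the function vanishes; for `n ≥ 1` it
  -- forces `|ε| ≤ 1`, as Bernoulli needs.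
  rcases Nat.eq_zero_or_pos n with rfl | hn
  · simp
  have hxc := (hx.trans_le (min_le_left _ _)).le
  have hx1 := (hx.trans_le (min_le_right _ _)).le
  have hn1 : (1 : ℝ) ≤ n := by exact_mod_cast hn
  have hε : |ε| ≤ 1 := by
    rw [abs_mul, Nat.abs_cast] at hx1
    nlinarith [abs_nonneg ε]
  have hlow := one_add_mul_le_pow (a := ε) (by linarith [(abs_le.mp hε).1]) n
  have h1 := one_add_pow_le_exp (abs_le.mp hε).1 n
  have h2 := (abs_le.mp (Real.abs_exp_sub_one_sub_id_le hx1)).2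
  rw [Real.norm_of_nonneg (by linarith), Real.norm_eq_abs]
  have h3 := mul_le_mul_of_nonneg_right hxc (abs_nonneg ((n : ℝ) * ε))
  rw [← sq, sq_abs] at h3
  linarith

/-! ### Entropy lower bound for independent schemes -/

theorem sum_le_prod_one_add_sub_one {n : ℕ} {a : Fin n → ℝ} (ha : ∀ i, 0 ≤ a i) :
    ∑ i, a i ≤ ∏ i, (1 + a i) - 1 := by
  have h : ∀ s : Finset (Fin n), 1 + ∑ i ∈ s, a i ≤ ∏ i ∈ s, (1 + a i) := by
    intro s
    induction s using Finset.induction_on with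
    | empty => simp
    | insert j s hj ih =>
      rw [Finset.sum_insert hj, Finset.prod_insert hj]
      nlinarith [ha j, Finset.sum_nonneg fun i (_ : i ∈ s) => ha i]
  linarith [h Finset.univ]

theorem tensorScheme_entropy {n : ℕ} (S : Fin n → EncryptionScheme (Fin 2)) :
    (tensorScheme S).entropy = ∑ i, (S i).entropy := by
  classical
  -- Each summand of the logarithm of the product is written as a product over the qubits, so that
  -- its sum over all keys factorizes. If some weight vanishes, both sides are `0`.
  have h1 : ∀ k : (∀ i, (S i).key), (∏ i, (S i).weight (k i)) *
      Real.logb 2 (∏ i, (S i).weight (k i)) =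
      ∑ i, ∏ j, ((S j).weight (k j) * if j = i then Real.logb 2 ((S j).weight (k j)) else 1) := by
    intro k
    have h2 : ∀ i, ∏ j, ((S j).weight (k j) *
        if j = i then Real.logb 2 ((S j).weight (k j)) else 1) =
        (∏ j, (S j).weight (k j)) * Real.logb 2 ((S i).weight (k i)) := by
      intro i
      rw [Finset.prod_mul_distrib, Finset.prod_ite_eq']
      simp
    simp_rw [h2, ← Finset.mul_sum]
    by_cases h0 : ∃ i, (S i).weight (k i) = 0
    · obtain ⟨i, hi⟩ := h0
      rw [Finset.prod_eq_zero (Finset.mem_univ i) hi, zero_mul, zero_mul]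
    · push Not at h0
      rw [Real.logb_prod _ _ fun i _ => h0 i]
  have h3 : ∀ i, ∑ k : (∀ i, (S i).key), ∏ j, ((S j).weight (k j) *
      if j = i then Real.logb 2 ((S j).weight (k j)) else 1) = -(S i).entropy := by
    intro i
    have := Finset.prod_univ_sum (fun j => (Finset.univ : Finset (S j).key)) fun j x =>
      (S j).weight x * if j = i then Real.logb 2 ((S j).weight x) else 1
    rw [Fintype.piFinset_univ] at this
    rw [← this, Finset.prod_eq_single i]
    · simp [EncryptionScheme.entropy]
    · intro j _ hj
      simp [hj, (S j).weight_sum]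
    · simp
  have h4 : (tensorScheme S).entropy = -∑ k : (∀ i, (S i).key), (∏ i, (S i).weight (k i)) *
      Real.logb 2 (∏ i, (S i).weight (k i)) := rfl
  rw [h4]
  simp_rw [h1]
  rw [Finset.sum_comm]
  simp_rw [h3]
  rw [Finset.sum_neg_distrib, neg_neg]

theorem EncryptionScheme.distMixed_nonneg {d : Type} [Fintype d] [DecidableEq d]
    (S : EncryptionScheme d) (ν : NormIndex) (ρ : Matrix d d ℂ) : 0 ≤ S.distMixed ν ρ :=
  schattenNorm_nonneg _ _

/-- In the 2-norm the product input gives the bound `δ ^ 2`; in the operator norm `m ^ 2 ≤ m` gives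
`δ`. The right-hand side covers both cases. -/
theorem sum_sq_le_of_errorLe {n : ℕ} {S : Fin n → EncryptionScheme (Fin 2)} {m : Fin n → ℝ}
    (hS : ∀ i, (S i).Attains (m i)) (hm : ∀ i, m i ≤ 1) {ν : NormIndex} {δ : ℝ}
    (h : (tensorScheme S).ErrorLe ν δ) : ∑ i, m i ^ 2 ≤ |δ| + δ ^ 2 := by
  obtain ⟨ξ, hξ, htwo, hinf⟩ := exists_product_state hS
  have hcard : Fintype.card (Fin n → Fin 2) = 2 ^ n := by simp
  have h1 := h _ (IsState.tensorMatrix hξ)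
  have h2 := sum_le_prod_one_add_sub_one fun i => sq_nonneg (m i)
  refine h2.trans ?_
  have hpos : (0 : ℝ) < 2 ^ n := by positivity
  cases ν
  · have h3 := pow_le_pow_left₀ (EncryptionScheme.distMixed_nonneg _ _ _) h1 2
    rw [htwo, NormIndex.scale, hcard, div_pow, Real.sq_sqrt (Nat.cast_nonneg _)] at h3
    push_cast at h3
    have h4 := (div_le_div_iff_of_pos_right hpos).mp h3
    linarith [abs_nonneg δ]
  · have h3 := hinf.trans h1
    rw [NormIndex.scale, hcard] at h3
    push_cast at h3
    have h4 := (div_le_div_iff_of_pos_right hpos).mp h3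
    have h5 : ∏ i, (1 + m i ^ 2) ≤ ∏ i, (1 + m i) := by
      refine Finset.prod_le_prod (fun i _ => by positivity) fun i _ => ?_
      nlinarith [(hS i).nonneg, hm i]
    linarith [le_abs_self δ, sq_nonneg δ]

theorem tensorScheme_entropy_ge {n : ℕ} {S : Fin n → EncryptionScheme (Fin 2)} {ν : NormIndex}
    {δ : ℝ} (h : (tensorScheme S).ErrorLe ν δ) :
    2 * (n : ℝ) - 3 * (|δ| + δ ^ 2) / Real.log 2 ≤ (tensorScheme S).entropy := by
  choose q hq hatt using fun i => (S i).exists_pauli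
  have hatt' : ∀ i, (S i).Attains (pauliNorm (q i).1) := fun i => by
    obtain ⟨s, hs, h⟩ := exists_pauliNorm_eq (q i).1
    exact h ▸ hatt i s hs
  have h1 := sum_sq_le_of_errorLe hatt' (fun i => pauliNorm_le_one (q i)) h
  have h2 : ∑ i, (2 - (S i).entropy) ≤ ∑ i, 3 * pauliNorm (q i).1 ^ 2 / Real.log 2 :=
    Finset.sum_le_sum fun i _ => by linarith [two_sub_pauliScheme_entropy_le (q i), hq i]
  have h3 : 3 * (∑ i, pauliNorm (q i).1 ^ 2) / Real.log 2 ≤ 3 * (|δ| + δ ^ 2) / Real.log 2 := by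
    gcongr
  rw [← Finset.sum_div, ← Finset.mul_sum, Finset.sum_sub_distrib, Finset.sum_const,
    Finset.card_univ, Fintype.card_fin, nsmul_eq_mul] at h2
  rw [tensorScheme_entropy]
  linarith

/-! ### Optimality of tensor powers and the theorem -/

section OptimalPower

variable {ν : NormIndex} {p : stdSimplex ℝ (Fin 4)} {ε H : ℝ}

theorem IsOptimalPauli.pauliPower_errorLe (h : IsOptimalPauli ν p ε H) {μ : NormIndex} {n : ℕ}
    {S : Fin n → EncryptionScheme (Fin 2)} (hS : ∀ i, (S i).entropy ≤ H) {δ : ℝ}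
    (hδ : (tensorScheme S).ErrorLe μ δ) : (pauliPower p n).ErrorLe μ δ := by
  choose m hm hatt using fun i => h.exists_attains (hS i)
  obtain ⟨ξ, hξ, htwo, hinf⟩ := exists_product_state hatt
  have hε := h.eq_pauliNorm
  have hε0 : 0 ≤ ε := hε ▸ pauliNorm_nonneg _
  have hε1 : ε ≤ 1 := hε ▸ pauliNorm_le_one p
  have hf : ∀ s, s ≠ 0 → |pauliFactor p.1 s| ≤ ε := fun s hs => hε ▸ abs_pauliFactor_le _ hs
  intro ρ hρ
  -- The worst case of the power is compared with the competing scheme at the single product state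
  -- `ξ`, using `ε ≤ m i` for each factor.
  refine le_trans ?_ (hδ _ (IsState.tensorMatrix hξ))
  cases μ
  · refine (sq_le_sq₀ (EncryptionScheme.distMixed_nonneg _ _ _)
      (EncryptionScheme.distMixed_nonneg _ _ _)).mp ?_
    refine (pauliPower_distMixed_two_le hε1 hf hρ).trans ?_
    rw [htwo]
    gcongr
    calc (1 + ε ^ 2) ^ n = ∏ _i : Fin n, (1 + ε ^ 2) := by simp
      _ ≤ ∏ i, (1 + m i ^ 2) := Finset.prod_le_prod (fun i _ => by positivity) fun i _ => by
          have := hm i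
          gcongr
  · refine (pauliPower_distMixed_infty_le hε1 hf hρ).trans (le_trans ?_ hinf)
    gcongr
    calc (1 + ε) ^ n = ∏ _i : Fin n, (1 + ε) := by simp
      _ ≤ ∏ i, (1 + m i) := Finset.prod_le_prod (fun i _ => by positivity) fun i _ => by
          have := hm i
          gcongr

theorem IsOptimalPauli.distMixed_two (h : IsOptimalPauli ν p ε H) (n : ℕ) :
    (∀ ρ : Matrix (Fin n → Fin 2) (Fin n → Fin 2) ℂ, IsState ρ →
      (pauliPower p n).distMixed .two ρ ≤ √((1 + ε ^ 2) ^ n - 1) / (2 : ℝ) ^ ((n : ℝ) / 2)) ∧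
    ∃ ξ : Fin n → Matrix (Fin 2) (Fin 2) ℂ, (∀ i, IsState (ξ i)) ∧
      (pauliPower p n).distMixed .two (tensorMatrix ξ) =
        √((1 + ε ^ 2) ^ n - 1) / (2 : ℝ) ^ ((n : ℝ) / 2) := by
  have hε := h.eq_pauliNorm
  have hf : ∀ s, s ≠ 0 → |pauliFactor p.1 s| ≤ ε := fun s hs => hε ▸ abs_pauliFactor_le _ hs
  have hpow : ((2 : ℝ) ^ ((n : ℝ) / 2)) ^ 2 = 2 ^ n := by
    rw [← Real.rpow_natCast, ← Real.rpow_mul (by norm_num), ← Real.rpow_natCast]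
    congr 1
    push_cast
    ring
  have hsq : (√((1 + ε ^ 2) ^ n - 1) / (2 : ℝ) ^ ((n : ℝ) / 2)) ^ 2 =
      ((1 + ε ^ 2) ^ n - 1) / 2 ^ n := by
    rw [div_pow, hpow, Real.sq_sqrt]
    exact sub_nonneg.mpr (one_le_pow₀ (by nlinarith [sq_nonneg ε]))
  have h0 : 0 ≤ √((1 + ε ^ 2) ^ n - 1) / (2 : ℝ) ^ ((n : ℝ) / 2) := by positivity
  constructor
  · intro ρ hρ
    refine (sq_le_sq₀ (EncryptionScheme.distMixed_nonneg _ _ _) h0).mp ?_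
    rw [hsq]
    exact pauliPower_distMixed_two_le (hε ▸ pauliNorm_le_one p) hf hρ
  · obtain ⟨ξ, hξ, htwo, -⟩ := exists_product_state fun _ : Fin n => pauliScheme_attains_norm p
    refine ⟨ξ, hξ, (sq_eq_sq₀ (EncryptionScheme.distMixed_nonneg _ _ _) h0).mp ?_⟩
    rw [hsq, pauliPower, htwo, ← hε]
    simp

theorem IsOptimalPauli.distMixed_infty (h : IsOptimalPauli ν p ε H) (n : ℕ) :
    (∀ ρ : Matrix (Fin n → Fin 2) (Fin n → Fin 2) ℂ, IsState ρ →
      (pauliPower p n).distMixed .infty ρ ≤ ((1 + ε) ^ n - 1) / 2 ^ n) ∧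
    ∃ ξ : Fin n → Matrix (Fin 2) (Fin 2) ℂ, (∀ i, IsState (ξ i)) ∧
      (pauliPower p n).distMixed .infty (tensorMatrix ξ) = ((1 + ε) ^ n - 1) / 2 ^ n := by
  have hε := h.eq_pauliNorm
  have hf : ∀ s, s ≠ 0 → |pauliFactor p.1 s| ≤ ε := fun s hs => hε ▸ abs_pauliFactor_le _ hs
  have hle : ∀ ρ : Matrix (Fin n → Fin 2) (Fin n → Fin 2) ℂ, IsState ρ →
      (pauliPower p n).distMixed .infty ρ ≤ ((1 + ε) ^ n - 1) / 2 ^ n := fun ρ hρ =>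
    pauliPower_distMixed_infty_le (hε ▸ pauliNorm_le_one p) hf hρ
  refine ⟨hle, ?_⟩
  obtain ⟨ξ, hξ, -, hinf⟩ := exists_product_state fun _ : Fin n => pauliScheme_attains_norm p
  refine ⟨ξ, hξ, le_antisymm (hle _ (IsState.tensorMatrix hξ)) ?_⟩
  rw [pauliPower]
  simpa [← hε] using hinf

end OptimalPower

theorem theorem2 :
    -- for every achievable entropy there is an optimal Pauli scheme
    (∀ (ν : NormIndex) (H : ℝ), 0 ≤ H → H ≤ 2 →
      ∃ (p : stdSimplex ℝ (Fin 4)) (ε : ℝ), IsOptimalPauli ν p ε H) ∧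
    -- `P^{⊗n}` is optimal, in both norms `μ`, among the independent schemes, and does not depend
    -- on the norm `ν` in which `P` is optimal
    (∀ (ν : NormIndex) (p : stdSimplex ℝ (Fin 4)) (ε H : ℝ), IsOptimalPauli ν p ε H →
      ∀ (μ : NormIndex) (n : ℕ) (S : Fin n → EncryptionScheme (Fin 2)),
        (∀ i, (S i).entropy ≤ H) →
        ∀ δ : ℝ, (tensorScheme S).ErrorLe μ δ → (pauliPower p n).ErrorLe μ δ) ∧
    -- the bound in the 2-norm, attained by a product state
    (∃ g : ℕ → ℝ → ℝ,
      ((fun q : ℕ × ℝ => g q.1 q.2) =o[comap (fun q : ℕ × ℝ => √(q.1 : ℝ) * q.2) (𝓝 0)]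
        fun q : ℕ × ℝ => √(q.1 : ℝ) * q.2) ∧
      ∀ (ν : NormIndex) (p : stdSimplex ℝ (Fin 4)) (ε H : ℝ), IsOptimalPauli ν p ε H → ∀ n : ℕ,
        (∀ ρ : Matrix (Fin n → Fin 2) (Fin n → Fin 2) ℂ, IsState ρ →
          (pauliPower p n).distMixed NormIndex.two ρ ≤
            √(n : ℝ) * (ε / (2 : ℝ) ^ ((n : ℝ) / 2)) + g n ε / (2 : ℝ) ^ ((n : ℝ) / 2)) ∧
        ∃ ξ : Fin n → Matrix (Fin 2) (Fin 2) ℂ, (∀ i, IsState (ξ i)) ∧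
          (pauliPower p n).distMixed NormIndex.two (tensorMatrix ξ) =
            √(n : ℝ) * (ε / (2 : ℝ) ^ ((n : ℝ) / 2)) + g n ε / (2 : ℝ) ^ ((n : ℝ) / 2)) ∧
    -- the bound in the operator norm, attained by a product state
    (∃ g : ℕ → ℝ → ℝ,
      ((fun q : ℕ × ℝ => g q.1 q.2) =o[comap (fun q : ℕ × ℝ => (q.1 : ℝ) * q.2) (𝓝 0)]
        fun q : ℕ × ℝ => (q.1 : ℝ) * q.2) ∧
      ∀ (ν : NormIndex) (p : stdSimplex ℝ (Fin 4)) (ε H : ℝ), IsOptimalPauli ν p ε H → ∀ n : ℕ,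
        (∀ ρ : Matrix (Fin n → Fin 2) (Fin n → Fin 2) ℂ, IsState ρ →
          (pauliPower p n).distMixed NormIndex.infty ρ ≤
            (n : ℝ) * (ε / (2 : ℝ) ^ n) + g n ε / (2 : ℝ) ^ n) ∧
        ∃ ξ : Fin n → Matrix (Fin 2) (Fin 2) ℂ, (∀ i, IsState (ξ i)) ∧
          (pauliPower p n).distMixed NormIndex.infty (tensorMatrix ξ) =
            (n : ℝ) * (ε / (2 : ℝ) ^ n) + g n ε / (2 : ℝ) ^ n) ∧
    -- independent schemes need `2 n - o(n)` bits of entropy for any fixed accuracy `δ`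
    (∀ (ν : NormIndex) (δ : ℝ), ∃ f : ℕ → ℝ, f =o[atTop] (fun n : ℕ => (n : ℝ)) ∧
      ∀ (n : ℕ) (S : Fin n → EncryptionScheme (Fin 2)), (tensorScheme S).ErrorLe ν δ →
        2 * (n : ℝ) - f n ≤ (tensorScheme S).entropy) := by
  refine ⟨fun ν H h0 h2 => exists_isOptimalPauli ν h0 h2,
    fun ν p ε H h μ n S hS δ hδ => h.pauliPower_errorLe hS hδ,
    ⟨fun n ε => if 0 ≤ ε then √((1 + ε ^ 2) ^ n - 1) - √(n : ℝ) * ε else 0,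
      isLittleO_sqrt_one_add_sq_pow, fun ν p ε H h n => ?_⟩,
    ⟨fun n ε => (1 + ε) ^ n - 1 - (n : ℝ) * ε, isLittleO_one_add_pow, fun ν p ε H h n => ?_⟩, fun ν δ => ?_⟩
  · have hε : 0 ≤ ε := h.eq_pauliNorm ▸ pauliNorm_nonneg _
    have e : √(n : ℝ) * (ε / (2 : ℝ) ^ ((n : ℝ) / 2)) +
        (if 0 ≤ ε then √((1 + ε ^ 2) ^ n - 1) - √(n : ℝ) * ε else 0) / (2 : ℝ) ^ ((n : ℝ) / 2) =
        √((1 + ε ^ 2) ^ n - 1) / (2 : ℝ) ^ ((n : ℝ) / 2) := by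
      rw [if_pos hε]
      ring
    simp only [e]
    exact h.distMixed_two n
  · have e : (n : ℝ) * (ε / (2 : ℝ) ^ n) + ((1 + ε) ^ n - 1 - (n : ℝ) * ε) / (2 : ℝ) ^ n =
        ((1 + ε) ^ n - 1) / 2 ^ n := by
      ring
    simp only [e]
    exact h.distMixed_infty n
  -- The constant function suffices for `f`, since the total deficit is bounded in terms of `δ`
  -- alone.
  · exact ⟨fun _ => 3 * (|δ| + δ ^ 2) / Real.log 2,
      isLittleO_const_left.mpr (Or.inr (tendsto_norm_atTop_atTop.comp tendsto_natCast_atTop_atTop)),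
      fun n S hS => tensorScheme_entropy_ge hS⟩
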